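/- Setting. Let $X=\mathbb R^n$, $g:\mathbb R^m\to\mathbb R$, and let $U=\{v\in\mathbb R^m : g(v)\le 0\}$ be nonempty. Let $F:X\times U\to\mathbb R^n$ and $C:X\times U\to\mathbb R$ be continuous. Let $X_g\subset X$ be compact, and let $D$ be a real function on $X$, continuous on $X_g$. Let $S\subset X$ be compact, and let $\varphi_+\ge 0$ be integrable and zero outside $S$. Consider $\dot x=F(x,u)$. For a strategy $u:X\to U$ write $F_u(x)=F(x,u(x))$, $C_u(x)=C(x,u(x))$. Density problem. Let $\mathcal K$ be the set of triples $p=(\rho,u,\nu)$ such that: $u:X\to U$ is measurable; $\rho\ge0$ is integrable, has compact support and vanishes on $X_g$; $\rho F_u$ and $\rho C_u$ are integrable; $\nu$ is a finite Borel measure on $X$ with $\nu(X\setminus X_g)=0$ and $\nu=\varphi_+\,dx$ on $\mathrm{int}(X_g)$. Put $\varphi_-=-\nu$ and $\varphi=\varphi_++\varphi_-$ (thus $\varphi_-$ is zero outside $X_g$, is $-\varphi_+$ in its interior, and on $\partial X_g$ it is a singular sink that removes the arriving states). The density problem is $$\min_{p\in\mathcal K} J(p)=\langle \rho,C_u\rangle-\langle\varphi_-,D\rangle=\int\rho\,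 C_u\,dx+\int D\,d\nu\quad\text{subject to}\quad \nabla\cdot(\rho F_u)=\varphi\ \text{ in the sense of distributions on } X .$$ Value-function (stationary HJB) problem. Let $\mathcal M$ be the set of locally Lipschitz functions $\mu:X\to\mathbb R$ that are differentiable at every point of $X\setminus X_g$. A pair $(V,u^\star)$ with $V\in\mathcal M$ and $u^\star:X\to U$ measurable solves the HJB problem if $V=D$ on $X_g$ and, for all $x\notin X_g$, $u^\star(x)$ minimizes $v\mapsto\nabla V(x)\cdot F(x,v)+C(x,v)$ over $U$ and $C_{u^\star}(x)+\nabla V(x)\cdot F_{u^\star}(x)=0$. Its value is $\langle\varphi_+,V\rangle=\int\varphi_+V\,dx$. Lagrangian. For $p\in\mathcal K$, $\mu\in\mathcal M$ let $$L(p,\mu)=J(p)+\langle\mu,\varphi-\nabla\cdot(\rho F_u)\rangle:=J(p)+\int\mu\varphi_+\,dx-\int\mu\,d\nu+\int\rho\,\nabla\mu\cdot F_u\,dx,$$ and $q(\mu)=\inf_{p\in\mathcal K}L(p,\mu)$. Call $\mu\in\mathcal M$ dual feasible if $\mu\le D$ on $\partial X_g$ and, for every $v\in U$, $\nabla\mu(x)\cdot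 F(x,v)+C(x,v)\ge0$ for almost every $x\notin X_g$. Theorem. (1) (The two problems are dual to each other.) For $\mu\in\mathcal M$: if $\mu$ is dual feasible then $q(\mu)=\langle\varphi_+,V_\mu\rangle$, where $V_\mu=D$ on $\mathrm{int}(X_g)$ and $V_\mu=\mu$ elsewhere; otherwise $q(\mu)=-\infty$. Conversely, for $p=(\rho,u,\nu)\in\mathcal K$, $\sup_{\mu\in\mathcal M}L(p,\mu)$ equals $J(p)$ if $\nabla\cdot(\rho F_u)=\varphi$, and $+\infty$ otherwise. (2) (No duality gap.) Let $(V,u^\star)$ solve the HJB problem. Suppose that $F_{u^\star}$ is locally Lipschitz on $X\setminus X_g$ and bounded on $S\setminus X_g$; that from every $x\in S$ a trajectory of $\dot x=F_{u^\star}(x)$ stays in $S$ until it reaches $X_g$ for the first time, at a finite time $\tau(x)$; and that $\varphi_+\tau$ is integrable. Then $V$ is dual feasible, $q(V)=\langle\varphi_+,V\rangle$, and $V$ maximizes $q$ over $\mathcal M$. If moreover $(\rho_s,u,\nu)$ is an optimal solution of the density problem, then $$\langle\varphi_+,V\rangle=\langle C_u,\rho_s\rangle-\langle\varphi_-,D\rangle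 ,\qquad \varphi_-=-\nu .$$ Moreover every maximizer $\mu\in\mathcal M$ of $q$ satisfies, for almost every $x$ with $\rho_s(x)>0$, that $u(x)$ minimizes $\nabla\mu(x)\cdot F(x,\cdot)+C(x,\cdot)$ over $U$ and $C_u(x)+\nabla\mu(x)\cdot F_u(x)=0$, and $\mu=D$ $\nu$-almost everywhere on $\partial X_g$. In particular there is no duality gap when both problems have unique optimal solutions $V$, $\rho_s$ and $\rho_s$ is differentiable; neither uniqueness nor differentiability of $\rho_s$ is needed. -/

import Mathlib

open MeasureTheory Set

noncomputable section

/-- Euclidean space of dimension `n`. -/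
abbrev Euc (n : ℕ) : Type := EuclideanSpace ℝ (Fin n)

/-- The data of an optimal control problem with a terminal set on `ℝⁿ`, with controls in `ℝᵐ`. -/
structure ControlProblem (n m : ℕ) where
  /-- the dynamics `ẋ = F(x, u)` -/
  F : Euc n → Euc m → Euc n
  /-- the running cost `C(x, u)` -/
  C : Euc n → Euc m → ℝ
  /-- the terminal cost -/
  D : Euc n → ℝ
  /-- the control constraint `g(u) ≤ 0` -/
  g : Euc m → ℝ
  /-- the terminal set `X_g` -/
  target : Set (Euc n)
  /-- the positive supply `φ₊` -/
  supply : Euc n → ℝ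

/-- The decision variables of the density optimization. -/
structure DensityDecision (n m : ℕ) where
  /-- the density `ρ` of states -/
  rho : Euc n → ℝ
  /-- the feedback strategy `x ↦ u(x)` -/
  u : Euc n → Euc m
  /-- the absorption measure: the negative supply is `φ₋ = -sink` -/
  sink : Measure (Euc n)

namespace ControlProblem

variable {n m : ℕ} (P : ControlProblem n m)

/-- The set `U = {v | g(v) ≤ 0}` of admissible control values. -/
def controlSet : Set (Euc m) := {v | P.g v ≤ 0}

/-- The closed-loop vector field `F_u(x) = F(x, u(x))`. -/
def closedLoop (u : Euc n → Euc m) (x : Euc n) : Euc n := P.F x (u x)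

/-- The closed-loop running cost `C_u(x) = C(x, u(x))`. -/
def closedLoopCost (u : Euc n → Euc m) (x : Euc n) : ℝ := P.C x (u x)

/-- The quantity `∇V(x) · F(x, v) + C(x, v)` that is minimized over `v` in the HJB equation. -/
def hamiltonian (V : Euc n → ℝ) (x : Euc n) (v : Euc m) : ℝ :=
  fderiv ℝ V x (P.F x v) + P.C x v

/-! ### The density problem -/

/-- All constraints of the density problem except the Liouville equation.  The negative supply
`φ₋ = -sink` vanishes outside the target, equals `-φ₊` on its interior, and is a singular sink on
its boundary which removes all states that arrive there: the density is zero on the target. -/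
structure IsDensityDecision (p : DensityDecision n m) : Prop where
  measurable_u : Measurable p.u
  u_mem : ∀ x, p.u x ∈ P.controlSet
  rho_nonneg : ∀ x, 0 ≤ p.rho x
  rho_integrable : Integrable p.rho
  rho_compact : HasCompactSupport p.rho
  rho_target : ∀ x ∈ P.target, p.rho x = 0
  flux_integrable : Integrable (fun x => p.rho x • P.closedLoop p.u x)
  cost_integrable : Integrable (fun x => p.rho x * P.closedLoopCost p.u x)
  sink_finite : IsFiniteMeasure p.sink
  sink_compl : p.sink P.targetᶜ = 0
  sink_interior : p.sink.restrict (interior P.target) =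
    (volume.restrict (interior P.target)).withDensity (fun x => ENNReal.ofReal (P.supply x))

/-- The set of all decisions that satisfy every constraint except the Liouville equation. -/
def decisions : Set (DensityDecision n m) := {p | P.IsDensityDecision p}

/-- The pairing `⟨ψ, φ - ∇ · (ρ F_u)⟩` with `φ = φ₊ + φ₋ = φ₊ - sink`, the divergence being moved
to `ψ`. -/
def liouvillePairing (p : DensityDecision n m) (ψ : Euc n → ℝ) : ℝ :=
  (∫ x, ψ x * P.supply x) - (∫ x, ψ x ∂p.sink) +
    ∫ x, p.rho x * fderiv ℝ ψ x (P.closedLoop p.u x)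

/-- The stationary Liouville equation `∇ · (ρ F_u) = φ₊ + φ₋` in the sense of distributions. -/
def IsStationary (p : DensityDecision n m) : Prop :=
  ∀ ψ : Euc n → ℝ, ContDiff ℝ (⊤ : ℕ∞) ψ → HasCompactSupport ψ → P.liouvillePairing p ψ = 0

/-- The objective `⟨ρ, C_u⟩ - ⟨φ₋, D⟩`. -/
def densityCost (p : DensityDecision n m) : ℝ :=
  (∫ x, p.rho x * P.closedLoopCost p.u x) + ∫ x, P.D x ∂p.sink

/-- `p` is an optimal solution of the density problem. -/
def IsOptimalDensity (p : DensityDecision n m) : Prop :=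
  p ∈ P.decisions ∧ P.IsStationary p ∧
    ∀ q ∈ P.decisions, P.IsStationary q → P.densityCost p ≤ P.densityCost q

/-! ### Lagrangian duality -/

/-- Multipliers for the Liouville equation (and candidate value functions): locally Lipschitz,
and differentiable outside the target. -/
def multipliers : Set (Euc n → ℝ) :=
  {μ | LocallyLipschitz μ ∧ ∀ x ∉ P.target, DifferentiableAt ℝ μ x}

/-- The Lagrangian of the density problem; the multiplier `μ` belongs to the Liouville equation. -/
def lagrangian (p : DensityDecision n m) (μ : Euc n → ℝ) : ℝ :=
  P.densityCost p + P.liouvillePairing p μ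

/-- The Lagrange dual function of the density problem. -/
def dualFunction (μ : Euc n → ℝ) : EReal :=
  ⨅ p ∈ P.decisions, ((P.lagrangian p μ : ℝ) : EReal)

/-- The function which is `D` on the interior of the target and `μ` elsewhere. -/
def valueExtension (μ : Euc n → ℝ) : Euc n → ℝ :=
  open Classical in (interior P.target).piecewise P.D μ

/-- `⟨φ₊, V⟩`, the objective of the value-function problem. -/
def valueObjective (V : Euc n → ℝ) : ℝ := ∫ x, P.supply x * V x

/-- The HJB inequality `∇μ · F(x, v) + C(x, v) ≥ 0` outside the target, with `μ ≤ D` on the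
boundary of the target. -/
def IsSubsolution (μ : Euc n → ℝ) : Prop :=
  (∀ v ∈ P.controlSet, ∀ᵐ x, x ∉ P.target → 0 ≤ P.hamiltonian μ x v) ∧
    ∀ x ∈ frontier P.target, μ x ≤ P.D x

/-! ### The value-function problem -/

/-- `(V, u)` solves the stationary HJB problem. -/
structure IsHJBSolution (V : Euc n → ℝ) (u : Euc n → Euc m) : Prop where
  regular : V ∈ P.multipliers
  measurable_u : Measurable u
  u_mem : ∀ x, u x ∈ P.controlSet
  argmin : ∀ x ∉ P.target, IsMinOn (P.hamiltonian V x) P.controlSet (u x)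
  hjb : ∀ x ∉ P.target, P.closedLoopCost u x + fderiv ℝ V x (P.closedLoop u x) = 0
  terminal : ∀ x ∈ P.target, V x = P.D x

/-- `γ` is a trajectory of the closed loop under `u` that starts at `x`, stays in `S`, and reaches
the target for the first time at time `T`. -/
structure IsTrajectory (u : Euc n → Euc m) (S : Set (Euc n)) (x : Euc n) (T : ℝ)
    (γ : ℝ → Euc n) : Prop where
  time_nonneg : 0 ≤ T
  start : γ 0 = x
  continuousOn : ContinuousOn γ (Icc 0 T)
  ode : ∀ t ∈ Ioo 0 T, HasDerivAt γ (P.closedLoop u (γ t)) t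
  invariant : ∀ t ∈ Icc 0 T, γ t ∈ S
  before : ∀ t ∈ Ico 0 T, γ t ∉ P.target
  arrival : γ T ∈ P.target

/-- The closed loop under `u` is regular (bounded on `S` and locally Lipschitz, outside the target),
all states that start in `S` stay in `S` and reach the target, at the finite time `τ x`, and the
total time `∫ φ₊ τ` that the supplied states spend in the system is finite. -/
structure IsAbsorbing (u : Euc n → Euc m) (S : Set (Euc n)) (τ : Euc n → ℝ) : Prop where
  lipschitz : LocallyLipschitzOn P.targetᶜ (P.closedLoop u)
  bounded : ∃ M : ℝ, ∀ x ∈ S \ P.target, ‖P.closedLoop u x‖ ≤ M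
  trajectory : ∀ x ∈ S, ∃ γ : ℝ → Euc n, P.IsTrajectory u S x (τ x) γ
  finite_mass : Integrable (fun x => P.supply x * τ x)

end ControlProblem

end

/-! Since the sink is prescribed on int(X_g), the Lagrangian splits (`lagrangian_eq`) as L(p, μ) = ∫
ρ (∇μ·F_u + C_u) dx + ∫_{∂X_g} (D - μ) dν + ⟨φ₊, V_μ⟩. The density and the boundary sink can be
scaled freely, so the infimum over p is ⟨φ₊, V_μ⟩ if both integrands are nonnegative and -∞
otherwise. Conversely, L(p, μ) is J(p) plus a term linear in μ, so its supremum over μ is J(p) or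
+∞.

Two facts about Lipschitz functions, both proved by mollification, make this rigorous. Dual
feasibility holds only almost everywhere, with a null set depending on v, whereas a feedback u(x)
varies with x and a trajectory may itself be null; `LipschitzWith.le_fderiv_of_ae_le` extends the
inequality to every point of differentiability. And the Liouville equation, known for smooth test
functions, extends to locally Lipschitz multipliers (`liouvillePairing_eq_zero`), which gives weak
duality.

V maximizes q because V - μ does not increase along optimal trajectories and is nonnegative on
arrival (`le_of_isTrajectory`). The gap closes because the occupation measure of these trajectories,
with the law of the arrival points as sink, is a stationary decision of cost ⟨φ₊, V⟩
(`exists_stationary_decision`). It has a density since, by Gronwall backward in time, the flow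
carries no set of positive volume into a null set. Equality of the values then forces the two
nonnegative terms of the splitting to vanish, which is complementary slackness. -/

noncomputable section

open Filter Topology ContinuousLinearMap
open scoped Convolution

/-! ### Mollification of Lipschitz functions and their derivatives. -/

/-- A sequence of bump functions around the origin whose supports shrink to it. -/
def shrinkingBump (n : ℕ) (k : ℕ) : ContDiffBump (0 : Euc n) where
  rIn := 1 / ((k : ℝ) + 1)
  rOut := 2 / ((k : ℝ) + 1)
  rIn_pos := by positivity
  rIn_lt_rOut := by gcongr; norm_num

/-- The mollification of `f` at scale `2 / (k + 1)`. -/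
def mollify {n : ℕ} (f : Euc n → ℝ) (k : ℕ) : Euc n → ℝ :=
  (shrinkingBump n k).normed volume ⋆[lsmul ℝ ℝ, volume] f

theorem shrinkingBump_rOut_tendsto (n : ℕ) :
    Tendsto (fun k => (shrinkingBump n k).rOut) atTop (𝓝 0) := by
  have := (tendsto_one_div_add_atTop_nhds_zero_nat (𝕜 := ℝ)).const_mul 2
  simpa [shrinkingBump, div_eq_mul_inv] using this

section Mollify

variable {n : ℕ} {f : Euc n → ℝ} {K : NNReal}

theorem mollify_apply (f : Euc n → ℝ) (k : ℕ) (x : Euc n) :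
    mollify f k x = ∫ t, (shrinkingBump n k).normed volume t * f (x - t) := rfl

theorem contDiff_mollify (hf : Continuous f) (k : ℕ) : ContDiff ℝ (⊤ : ℕ∞) (mollify f k) :=
  (shrinkingBump n k).hasCompactSupport_normed.contDiff_convolution_left _
    (shrinkingBump n k).contDiff_normed hf.locallyIntegrable

theorem tendsto_mollify (hf : Continuous f) (x : Euc n) :
    Tendsto (fun k => mollify f k x) atTop (𝓝 (f x)) :=
  ContDiffBump.convolution_tendsto_right_of_continuous (shrinkingBump_rOut_tendsto n) hf x

theorem integrable_normed_mul (hf : Continuous f) (k : ℕ) (x : Euc n) :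
    Integrable (fun t => (shrinkingBump n k).normed volume t * f (x - t)) :=
  Continuous.integrable_of_hasCompactSupport
    ((shrinkingBump n k).continuous_normed.mul (by fun_prop))
    (shrinkingBump n k).hasCompactSupport_normed.mul_right

theorem lipschitzWith_mollify (hf : LipschitzWith K f) (k : ℕ) :
    LipschitzWith K (mollify f k) := by
  refine LipschitzWith.of_dist_le_mul fun x y => ?_
  have hb := (shrinkingBump n k).integrable_normed (μ := (volume : Measure (Euc n)))
  rw [Real.dist_eq, mollify_apply, mollify_apply,
    ← integral_sub (integrable_normed_mul hf.continuous k x)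
      (integrable_normed_mul hf.continuous k y), ← Real.norm_eq_abs]
  calc ‖∫ t, ((shrinkingBump n k).normed volume t * f (x - t)
          - (shrinkingBump n k).normed volume t * f (y - t))‖
      ≤ ∫ t, (shrinkingBump n k).normed volume t * (K * dist x y) := by
        refine norm_integral_le_of_norm_le (hb.mul_const _) (ae_of_all _ fun t => ?_)
        rw [← mul_sub, norm_mul, Real.norm_of_nonneg ((shrinkingBump n k).nonneg_normed t)]
        refine mul_le_mul_of_nonneg_left ?_ ((shrinkingBump n k).nonneg_normed t)
        have := hf.dist_le_mul (x - t) (y - t)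
        rwa [dist_sub_right, Real.dist_eq] at this
    _ = K * dist x y := by
        rw [integral_mul_const, (shrinkingBump n k).integral_normed, one_mul]

/-- By Rademacher the derivative may fall on `f` instead of the bump, so the gradient of the
mollification is an average of gradients of `f` and inherits their almost-everywhere bounds. -/
theorem hasFDerivAt_mollify (hf : LipschitzWith K f) (k : ℕ) (x : Euc n) :
    Integrable (fun t => (shrinkingBump n k).normed volume t • fderiv ℝ f (x - t)) ∧
    HasFDerivAt (mollify f k)
      (∫ t, (shrinkingBump n k).normed volume t • fderiv ℝ f (x - t)) x := by
  have hb := (shrinkingBump n k).integrable_normed (μ := (volume : Measure (Euc n)))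
  have hdiff : ∀ᵐ t, DifferentiableAt ℝ f (x - t) :=
    (Measure.measurePreserving_sub_left (volume : Measure (Euc n)) x).quasiMeasurePreserving.ae
      hf.ae_differentiableAt
  refine hasFDerivAt_integral_of_dominated_loc_of_lip (s := univ)
    (F := fun x t => (shrinkingBump n k).normed volume t * f (x - t))
    (bound := fun t => (shrinkingBump n k).normed volume t * K) univ_mem
    (Eventually.of_forall fun y => (integrable_normed_mul hf.continuous k y).1)
    (integrable_normed_mul hf.continuous k x) ?_ ?_ (hb.mul_const _) ?_
  · refine (shrinkingBump n k).continuous_normed.aestronglyMeasurable.smul ?_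
    exact ((measurable_fderiv ℝ f).comp (measurable_const.sub measurable_id)).aestronglyMeasurable
  · refine ae_of_all _ fun t => (LipschitzWith.of_dist_le_mul fun y z => ?_).lipschitzOnWith
    have := hf.dist_le_mul (y - t) (z - t)
    rw [dist_sub_right, Real.dist_eq] at this
    have h0 := (shrinkingBump n k).nonneg_normed (μ := (volume : Measure (Euc n))) t
    rw [Real.dist_eq, ← mul_sub, abs_mul, abs_of_nonneg h0, Real.coe_nnabs, abs_of_nonneg
      (mul_nonneg h0 K.coe_nonneg), mul_assoc]
    exact mul_le_mul_of_nonneg_left this h0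
  · filter_upwards [hdiff] with t ht
    have h1 : HasFDerivAt (fun y => f (y - t)) (fderiv ℝ f (x - t)) x := by
      have h2 := ht.hasFDerivAt.comp x ((hasFDerivAt_id x).sub_const t)
      rw [ContinuousLinearMap.comp_id] at h2
      exact h2
    exact h1.const_mul _

theorem ae_tendsto_fderiv_mollify (hf : LipschitzWith K f) :
    ∀ᵐ x, Tendsto (fun k => fderiv ℝ (mollify f k) x) atTop (𝓝 (fderiv ℝ f x)) := by
  have hloc : LocallyIntegrable (fderiv ℝ f) (volume : Measure (Euc n)) := by
    refine (locallyIntegrable_const (K : ℝ)).mono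
      (measurable_fderiv ℝ f).aestronglyMeasurable (ae_of_all _ fun x => ?_)
    simpa using norm_fderiv_le_of_lipschitz ℝ hf
  -- Lebesgue differentiation needs a bounded ratio of outer to inner radius; here it is always 2.
  filter_upwards [ContDiffBump.ae_convolution_tendsto_right_of_locallyIntegrable (K := 2)
    (shrinkingBump_rOut_tendsto n) (Eventually.of_forall fun k => by
      simp [shrinkingBump, div_eq_mul_inv]) hloc] with x hx
  refine hx.congr fun k => ?_
  exact (hasFDerivAt_mollify hf k x).2.fderiv.symm

theorem le_fderiv_mollify (hf : LipschitzWith K f) {x w : Euc n} {c r : ℝ}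
    (h : ∀ᵐ y, y ∈ Metric.ball x (2 * r) → c ≤ fderiv ℝ f y w) {k : ℕ}
    (hk : (shrinkingBump n k).rOut < r) {z : Euc n} (hz : z ∈ Metric.ball x r) :
    c ≤ fderiv ℝ (mollify f k) z w := by
  obtain ⟨hi, hd⟩ := hasFDerivAt_mollify hf k z
  have hb := (shrinkingBump n k).integrable_normed (μ := (volume : Measure (Euc n)))
  rw [hd.fderiv, ContinuousLinearMap.integral_apply hi]
  have hae := (Measure.measurePreserving_sub_left (volume : Measure (Euc n))
    z).quasiMeasurePreserving.ae h
  have h1 : ∫ t, (shrinkingBump n k).normed (volume : Measure (Euc n)) t * c = c := by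
    rw [integral_mul_const, (shrinkingBump n k).integral_normed, one_mul]
  rw [← h1]
  refine integral_mono_ae (hb.mul_const _) (hi.apply_continuousLinearMap w) ?_
  filter_upwards [hae] with t ht
  simp only [FunLike.coe_smul, Pi.smul_apply, smul_eq_mul]
  by_cases hts : t ∈ Metric.ball (0 : Euc n) (shrinkingBump n k).rOut
  · refine mul_le_mul_of_nonneg_left (ht ?_) ((shrinkingBump n k).nonneg_normed t)
    rw [Metric.mem_ball] at hz ⊢
    rw [mem_ball_zero_iff] at hts
    calc dist (z - t) x ≤ dist (z - t) z + dist z x := dist_triangle _ _ _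
      _ < 2 * r := by rw [dist_eq_norm]; simp only [sub_sub_cancel_left, norm_neg]; linarith
  · have : (shrinkingBump n k).normed (volume : Measure (Euc n)) t = 0 := by
      rw [← Function.notMem_support, (shrinkingBump n k).support_normed_eq]; exact hts
    simp [this]

/-- An almost-everywhere lower bound for a directional derivative of a Lipschitz function
holds at every nearby point of differentiability. -/
theorem LipschitzWith.le_fderiv_of_ae_le (hf : LipschitzWith K f) {x w : Euc n} {c r : ℝ}
    (hr : 0 < r) (h : ∀ᵐ y, y ∈ Metric.ball x r → c ≤ fderiv ℝ f y w)
    (hx : DifferentiableAt ℝ f x) : c ≤ fderiv ℝ f x w := by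
  have hr2 : (0 : ℝ) < r / 2 := by positivity
  -- The bound is transferred through increments: it holds for the smooth mollifications along the
  -- segment, and their values converge at both endpoints. Mere differentiability at `x` then
  -- suffices, with no continuity of the gradient.
  have key : ∀ t : ℝ, 0 ≤ t → t * ‖w‖ < r / 2 → t * c ≤ f (x + t • w) - f x := by
    intro t ht htw
    have hlim := (tendsto_mollify hf.continuous (x + t • w)).sub (tendsto_mollify hf.continuous x)
    refine ge_of_tendsto hlim ?_
    filter_upwards [(shrinkingBump_rOut_tendsto n).eventually_lt_const hr2] with k hk
    have hder : ∀ s : ℝ, HasDerivAt (fun s : ℝ => mollify f k (x + s • w))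
        (fderiv ℝ (mollify f k) (x + s • w) w) s := fun s => by
      have h1 : HasDerivAt (fun s : ℝ => x + s • w) w s := by
        simpa using ((hasDerivAt_id s).smul_const w).const_add x
      exact (((contDiff_mollify hf.continuous k).differentiable (by simp)
        (x + s • w)).hasFDerivAt).comp_hasDerivAt s h1
    have := Convex.mul_sub_le_image_sub_of_le_deriv (convex_Icc 0 t)
      (f := fun s : ℝ => mollify f k (x + s • w)) (C := c)
      (fun s _ => (hder s).continuousAt.continuousWithinAt)
      (fun s _ => (hder s).differentiableAt.differentiableWithinAt)
      (fun s hs => ?_) 0 ⟨le_rfl, ht⟩ t ⟨ht, le_rfl⟩ ht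
    · simpa [mul_comm] using this
    · rw [interior_Icc] at hs
      rw [(hder s).deriv]
      refine le_fderiv_mollify hf (r := r / 2) (x := x) ?_ hk ?_
      · simpa [mul_div_cancel₀] using h
      · rw [mem_ball_iff_norm]
        simp only [add_sub_cancel_left, norm_smul, Real.norm_of_nonneg hs.1.le]
        exact lt_of_le_of_lt (mul_le_mul_of_nonneg_right hs.2.le (norm_nonneg _)) htw
  have hd : HasDerivAt (fun s : ℝ => f (x + s • w)) (fderiv ℝ f x w) 0 := by
    have h1 : HasDerivAt (fun s : ℝ => x + s • w) w 0 := by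
      simpa using ((hasDerivAt_id (0 : ℝ)).smul_const w).const_add x
    have h2 : HasFDerivAt f (fderiv ℝ f x) (x + (0 : ℝ) • w) := by simpa using hx.hasFDerivAt
    exact h2.comp_hasDerivAt 0 h1
  have hs := (hasDerivWithinAt_iff_tendsto_slope' (s := Ioi 0) (by simp)).1
    (hd.hasDerivWithinAt (s := Ioi 0))
  refine ge_of_tendsto hs ?_
  have h0 : ∀ᶠ t : ℝ in 𝓝[>] 0, t * ‖w‖ < r / 2 := by
    have : Tendsto (fun t : ℝ => t * ‖w‖) (𝓝[>] 0) (𝓝 (0 * ‖w‖)) :=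
      ((continuous_id.mul continuous_const).tendsto 0).mono_left nhdsWithin_le_nhds
    rw [zero_mul] at this
    exact this.eventually_lt_const hr2
  filter_upwards [h0, self_mem_nhdsWithin] with t ht ht0
  have ht0' : (0 : ℝ) < t := ht0
  rw [slope_def_field, sub_zero, le_div_iff₀ ht0', mul_comm]
  simpa using key t ht0'.le ht

end Mollify

/-! ### Integrability, Lipschitz test functions, and the Hamiltonian inequality at every point. -/

namespace ControlProblem

variable {n m : ℕ} {P : ControlProblem n m} {S : Set (Euc n)}

/-- The standing assumptions on the data of a control problem whose supply lives in `S`. -/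
structure IsRegular (P : ControlProblem n m) (S : Set (Euc n)) : Prop where
  continuousOn_F : ContinuousOn (Function.uncurry P.F) (univ ×ˢ P.controlSet)
  continuousOn_C : ContinuousOn (Function.uncurry P.C) (univ ×ˢ P.controlSet)
  nonempty : P.controlSet.Nonempty
  isCompact_target : IsCompact P.target
  continuousOn_D : ContinuousOn P.D P.target
  isCompact_S : IsCompact S
  supply_nonneg : ∀ x, 0 ≤ P.supply x
  integrable_supply : Integrable P.supply
  supply_eq_zero : ∀ x ∉ S, P.supply x = 0

/-- Multipliers are only locally Lipschitz; extending the restriction to a ball makes the global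
mollification lemmas available, and agreement of germs inside the ball identifies the derivatives.
-/
theorem exists_lipschitzWith_eqOn_ball {μ : Euc n → ℝ} (hμ : LocallyLipschitz μ) (R : ℝ) :
    ∃ (K : NNReal) (f : Euc n → ℝ), LipschitzWith K f ∧
      EqOn μ f (Metric.closedBall 0 R) ∧ ∀ x ∈ Metric.ball 0 R, μ =ᶠ[𝓝 x] f := by
  obtain ⟨K, hK⟩ := (hμ.locallyLipschitzOn (s := Metric.closedBall 0
    R)).exists_lipschitzOnWith_of_compact (isCompact_closedBall 0 R)
  obtain ⟨f, hf, he⟩ := hK.extend_real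
  exact ⟨K, f, hf, he, fun x hx => (he.mono Metric.ball_subset_closedBall).eventuallyEq_of_mem
    (Metric.isOpen_ball.mem_nhds hx)⟩

theorem exists_norm_fderiv_le {μ : Euc n → ℝ} (hμ : LocallyLipschitz μ) {A : Set (Euc n)}
    (hA : Bornology.IsBounded A) : ∃ K : ℝ, ∀ x ∈ A, ‖fderiv ℝ μ x‖ ≤ K := by
  obtain ⟨R, hR⟩ := hA.subset_ball 0
  obtain ⟨K, f, hf, -, he⟩ := exists_lipschitzWith_eqOn_ball hμ R
  refine ⟨K, fun x hx => ?_⟩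
  rw [(he x (hR hx)).fderiv_eq]
  exact norm_fderiv_le_of_lipschitz ℝ hf

namespace IsRegular

variable (hP : P.IsRegular S)
include hP

theorem isClosed_target : IsClosed P.target := hP.isCompact_target.isClosed

theorem continuous_F {v : Euc m} (hv : v ∈ P.controlSet) : Continuous fun x => P.F x v :=
  hP.continuousOn_F.comp_continuous (f := fun x => (x, v)) (by fun_prop) fun _ => ⟨trivial, hv⟩

theorem continuous_C {v : Euc m} (hv : v ∈ P.controlSet) : Continuous fun x => P.C x v :=
  hP.continuousOn_C.comp_continuous (f := fun x => (x, v)) (by fun_prop) fun _ => ⟨trivial, hv⟩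

theorem measurable_hamiltonian (μ : Euc n → ℝ) {v : Euc m} (hv : v ∈ P.controlSet) :
    Measurable fun x => P.hamiltonian μ x v := by
  refine Measurable.add ?_ (hP.continuous_C hv).measurable
  exact (isBoundedBilinearMap_apply (𝕜 := ℝ) (E := Euc n) (F := ℝ)).continuous.measurable.comp
    ((measurable_fderiv ℝ μ).prodMk (hP.continuous_F hv).measurable)

theorem integrable_supply_mul {ψ : Euc n → ℝ} (hψ : Continuous ψ) :
    Integrable fun x => ψ x * P.supply x := by
  have h1 : IntegrableOn (fun x => ψ x * P.supply x) S :=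
    hP.integrable_supply.integrableOn.continuousOn_mul hψ.continuousOn hP.isCompact_S
  exact h1.integrable_of_forall_notMem_eq_zero fun x hx => by simp [hP.supply_eq_zero x hx]

theorem integrableOn_target_supply_mul {ψ : Euc n → ℝ} (hψ : ContinuousOn ψ P.target) :
    IntegrableOn (fun x => ψ x * P.supply x) P.target :=
  hP.integrable_supply.integrableOn.continuousOn_mul hψ hP.isCompact_target

omit hP in
theorem restrict_sink {p : DensityDecision n m} (hp : P.IsDensityDecision p) :
    p.sink.restrict P.target = p.sink :=
  Measure.restrict_eq_self_of_ae_mem hp.sink_compl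

theorem integrable_sink {p : DensityDecision n m} (hp : P.IsDensityDecision p)
    {ψ : Euc n → ℝ} (hψ : ContinuousOn ψ P.target) : Integrable ψ p.sink := by
  have := hp.sink_finite
  rw [← restrict_sink hp]
  exact hψ.integrableOn_compact hP.isCompact_target

omit hP in
theorem integrable_flux {p : DensityDecision n m} (hp : P.IsDensityDecision p)
    {μ : Euc n → ℝ} (hμ : LocallyLipschitz μ) :
    Integrable fun x => p.rho x * fderiv ℝ μ x (P.closedLoop p.u x) := by
  obtain ⟨K, hK⟩ := exists_norm_fderiv_le hμ hp.rho_compact.isCompact.isBounded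
  -- The density is moved inside the derivative because measurability and integrability are given
  -- for the flux ρF_u.
  have heq : (fun x => p.rho x * fderiv ℝ μ x (P.closedLoop p.u x)) =
      fun x => fderiv ℝ μ x (p.rho x • P.closedLoop p.u x) := by ext; simp
  refine (hp.flux_integrable.norm.const_mul K).mono' ?_ (ae_of_all _ fun x => ?_)
  · rw [heq]
    exact (isBoundedBilinearMap_apply (𝕜 := ℝ) (E := Euc n)
      (F := ℝ)).continuous.comp_aestronglyMeasurable
      ((measurable_fderiv ℝ μ).aestronglyMeasurable.prodMk hp.flux_integrable.1)
  · by_cases hx : x ∈ tsupport p.rho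
    · have := (fderiv ℝ μ x).le_of_opNorm_le (hK x hx) (p.rho x • P.closedLoop p.u x)
      simpa using this
    · simp [image_eq_zero_of_notMem_tsupport hx]

/-- A stationary decision satisfies the Liouville equation when tested with a locally Lipschitz
function. -/
theorem liouvillePairing_eq_zero {p : DensityDecision n m} (hp : P.IsDensityDecision p)
    (hs : P.IsStationary p) {μ : Euc n → ℝ} (hμ : LocallyLipschitz μ) :
    P.liouvillePairing p μ = 0 := by
  have := hp.sink_finite
  obtain ⟨R, hR⟩ := ((hp.rho_compact.isCompact.isBounded.union
    hP.isCompact_target.isBounded).union hP.isCompact_S.isBounded).subset_ball 0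
  -- The maximum with 1 keeps the cutoff radius positive even if all the sets involved are empty.
  obtain ⟨K, f, hf, he, hloc⟩ := exists_lipschitzWith_eqOn_ball hμ (max R 1)
  have hR1 : Metric.ball (0 : Euc n) R ⊆ Metric.ball 0 (max R 1) :=
    Metric.ball_subset_ball (le_max_left _ _)
  have hrho : tsupport p.rho ⊆ Metric.ball 0 (max R 1) := fun x hx => hR1 (hR (.inl (.inl hx)))
  have htar : P.target ⊆ Metric.ball 0 (max R 1) := fun x hx => hR1 (hR (.inl (.inr hx)))
  have hS : S ⊆ Metric.ball 0 (max R 1) := fun x hx => hR1 (hR (.inr hx))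
  -- Test functions must have compact support. The cutoff is 1 on an open ball containing all three
  -- domains of integration, so its gradient never enters the pairing.
  set χ : ContDiffBump (0 : Euc n) :=
    ⟨max R 1, max R 1 + 1, by positivity, by linarith⟩ with hχdef
  have hχ : ∀ x ∈ Metric.ball (0 : Euc n) (max R 1), χ =ᶠ[𝓝 x] fun _ => 1 := fun x hx =>
    χ.eventuallyEq_one_of_mem_ball hx
  have hχ1 : ∀ x ∈ Metric.ball (0 : Euc n) (max R 1), χ x = 1 := fun x hx => (hχ x hx).eq_of_nhds
  set ψ : ℕ → Euc n → ℝ := fun k x => χ x * mollify f k x with hψ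
  have hψnhds : ∀ k, ∀ x ∈ Metric.ball (0 : Euc n) (max R 1), ψ k =ᶠ[𝓝 x] mollify f k :=
    fun k x hx => by filter_upwards [hχ x hx] with y hy; simp [hψ, hy]
  have hzero : ∀ k, P.liouvillePairing p (ψ k) = 0 := fun k =>
    hs _ (χ.contDiff.mul (contDiff_mollify hf.continuous k)) χ.hasCompactSupport.mul_right
  -- A common Lipschitz constant and boundedness at the origin give a uniform bound for dominated
  -- convergence.
  have hbound : ∀ x ∈ Metric.ball (0 : Euc n) (max R 1), ∀ k,
      |mollify f k x| ≤ |mollify f k 0| + K * max R 1 := fun x hx k => by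
    have h1 := (lipschitzWith_mollify hf k).dist_le_mul x 0
    rw [Real.dist_eq] at h1
    have h2 : (K : ℝ) * dist x 0 ≤ K * max R 1 :=
      mul_le_mul_of_nonneg_left (Metric.mem_ball.1 hx).le K.2
    have := abs_sub_abs_le_abs_sub (mollify f k x) (mollify f k 0)
    linarith
  obtain ⟨B, hB⟩ : ∃ B : ℝ, ∀ k, |mollify f k 0| ≤ B := by
    obtain ⟨B, hB⟩ := (tendsto_mollify hf.continuous 0).abs.bddAbove_range
    exact ⟨B, fun k => hB ⟨k, rfl⟩⟩
  have l1 : Tendsto (fun k => ∫ x, ψ k x * P.supply x) atTop (𝓝 (∫ x, μ x * P.supply x)) := by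
    refine tendsto_integral_of_dominated_convergence
      (fun x => (B + K * max R 1) * |P.supply x|) (fun k => ?_)
      (hP.integrable_supply.abs.const_mul _) (fun k => ae_of_all _ fun x => ?_)
      (ae_of_all _ fun x => ?_)
    · exact (χ.continuous.mul
        (contDiff_mollify hf.continuous k).continuous).aestronglyMeasurable.mul hP.integrable_supply.1
    · by_cases hx : x ∈ S
      · rw [norm_mul, (hψnhds k x (hS hx)).eq_of_nhds]
        refine mul_le_mul_of_nonneg_right ?_ (abs_nonneg _)
        exact (hbound x (hS hx) k).trans (by linarith [hB k])
      · simp [hP.supply_eq_zero x hx]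
    · by_cases hx : x ∈ S
      · refine Tendsto.mul_const _ ?_
        rw [(hloc x (hS hx)).eq_of_nhds]
        refine (tendsto_mollify hf.continuous x).congr fun k => ?_
        exact (hψnhds k x (hS hx)).eq_of_nhds.symm
      · simp [hP.supply_eq_zero x hx]
  have l2 : Tendsto (fun k => ∫ x, ψ k x ∂p.sink) atTop (𝓝 (∫ x, μ x ∂p.sink)) := by
    have hae : ∀ᵐ x ∂p.sink, x ∈ P.target := hp.sink_compl
    refine tendsto_integral_of_dominated_convergence (fun _ => B + K * max R 1) (fun k => ?_)
      (integrable_const _) (fun k => ?_) ?_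
    · exact (χ.continuous.mul (contDiff_mollify hf.continuous k).continuous).aestronglyMeasurable
    · filter_upwards [hae] with x hx
      rw [(hψnhds k x (htar hx)).eq_of_nhds]
      exact (hbound x (htar hx) k).trans (by linarith [hB k])
    · filter_upwards [hae] with x hx
      rw [(hloc x (htar hx)).eq_of_nhds]
      refine (tendsto_mollify hf.continuous x).congr fun k => ?_
      exact (hψnhds k x (htar hx)).eq_of_nhds.symm
  have l3 : Tendsto (fun k => ∫ x, p.rho x * fderiv ℝ (ψ k) x (P.closedLoop p.u x)) atTop
      (𝓝 (∫ x, p.rho x * fderiv ℝ μ x (P.closedLoop p.u x))) := by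
    have hψL : ∀ k, LocallyLipschitz (ψ k) := fun k =>
      ((χ.contDiff.mul (contDiff_mollify hf.continuous k)).of_le
        (by exact_mod_cast le_top) : ContDiff ℝ 1 _).locallyLipschitz
    refine tendsto_integral_of_dominated_convergence
      (fun x => K * ‖p.rho x • P.closedLoop p.u x‖) (fun k => (integrable_flux hp (hψL k)).1)
      (hp.flux_integrable.norm.const_mul _) (fun k => ae_of_all _ fun x => ?_) ?_
    · by_cases hx : x ∈ tsupport p.rho
      · have := (fderiv ℝ (ψ k) x).le_of_opNorm_le (c := K) (by
          rw [(hψnhds k x (hrho hx)).fderiv_eq]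
          exact norm_fderiv_le_of_lipschitz ℝ (lipschitzWith_mollify hf k))
          (p.rho x • P.closedLoop p.u x)
        simpa using this
      · simp [image_eq_zero_of_notMem_tsupport hx]
    · filter_upwards [ae_tendsto_fderiv_mollify hf] with x hx
      by_cases hxs : x ∈ tsupport p.rho
      · refine Tendsto.const_mul _ ?_
        rw [(hloc x (hrho hxs)).fderiv_eq]
        have h1 := ((ContinuousLinearMap.apply ℝ ℝ (P.closedLoop p.u x)).continuous.tendsto _).comp
          hx
        refine h1.congr fun k => ?_
        simp [(hψnhds k x (hrho hxs)).fderiv_eq]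
      · simp [image_eq_zero_of_notMem_tsupport hxs]
  have := (l1.sub l2).add l3
  exact tendsto_nhds_unique this (tendsto_const_nhds.congr fun k => (hzero k).symm)

/-- The Hamiltonian inequality for a fixed control holds at every point off the target as soon as
it holds almost everywhere there. -/
theorem hamiltonian_nonneg {μ : Euc n → ℝ} (hμ : μ ∈ P.multipliers) {v : Euc m}
    (hv : v ∈ P.controlSet) (h : ∀ᵐ x, x ∉ P.target → 0 ≤ P.hamiltonian μ x v)
    {x : Euc n} (hx : x ∉ P.target) : 0 ≤ P.hamiltonian μ x v := by
  obtain ⟨K, f, hf, -, hloc⟩ := exists_lipschitzWith_eqOn_ball hμ.1 (‖x‖ + 1)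
  have hxb : x ∈ Metric.ball (0 : Euc n) (‖x‖ + 1) := by simp
  refine le_of_forall_pos_le_add fun ε hε => ?_
  -- The derivative bound needs a fixed direction, so F(y, v) is frozen at F(x, v); the Lipschitz
  -- constant controls this error, and ε absorbs it together with the variation of the cost.
  have hcont : ContinuousAt (fun y => K * ‖P.F y v - P.F x v‖ + P.C y v) x :=
    ((continuous_const.mul (((hP.continuous_F hv).sub continuous_const).norm)).add
      (hP.continuous_C hv)).continuousAt
  have hev : ∀ᶠ y in 𝓝 x, K * ‖P.F y v - P.F x v‖ + P.C y v < P.C x v + ε :=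
    hcont.eventually_lt_const (by simpa using hε)
  obtain ⟨r, hr, hball⟩ := Metric.eventually_nhds_iff_ball.1 (hev.and
    ((hP.isClosed_target.isOpen_compl.eventually_mem hx).and
      (Metric.isOpen_ball.eventually_mem hxb)))
  have key : -(P.C x v + ε) ≤ fderiv ℝ f x (P.F x v) := by
    refine hf.le_fderiv_of_ae_le hr ?_ ?_
    · filter_upwards [h] with y hy hyb
      obtain ⟨h1, h2, h3⟩ := hball y hyb
      have h4 : 0 ≤ fderiv ℝ f y (P.F y v) + P.C y v := by
        have := hy h2
        rwa [hamiltonian, (hloc y h3).fderiv_eq] at this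
      have h5 := ((fderiv ℝ f y).le_of_opNorm_le (norm_fderiv_le_of_lipschitz ℝ hf)
        (P.F y v - P.F x v))
      rw [map_sub] at h5
      have h6 := (le_abs_self _).trans h5
      linarith
    · exact ((hloc x hxb).differentiableAt_iff).1 (hμ.2 x hx)
  rw [hamiltonian, (hloc x hxb).fderiv_eq]
  linarith

end IsRegular

/-- The inequality is required at every point off the target: the control `p.u x` changes with `x`,
so null sets depending on `v` could not be discarded. -/
theorem rho_mul_hamiltonian_nonneg {μ : Euc n → ℝ} {p : DensityDecision n m}
    (hp : P.IsDensityDecision p)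
    (h : ∀ v ∈ P.controlSet, ∀ x ∉ P.target, 0 ≤ P.hamiltonian μ x v) (x : Euc n) :
    0 ≤ p.rho x * P.hamiltonian μ x (p.u x) := by
  by_cases hx : x ∈ P.target
  · simp [hp.rho_target x hx]
  · exact mul_nonneg (hp.rho_nonneg x) (h _ (hp.u_mem x) x hx)

end ControlProblem

/-! ### The splitting of the Lagrangian and the two extremal problems over it. -/

theorem EReal.eq_bot_of_forall_nat_mul_add {x : EReal} {a b : ℝ} (ha : a < 0)
    (h : ∀ k : ℕ, x ≤ ((k * a + b : ℝ) : EReal)) : x = ⊥ := by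
  refine (EReal.eq_bot_iff_forall_lt x).2 fun y => ?_
  obtain ⟨k, hk⟩ := exists_nat_gt ((y - b) / a)
  refine (h k).trans_lt (EReal.coe_lt_coe_iff.2 ?_)
  rw [div_lt_iff_of_neg ha] at hk
  linarith

namespace ControlProblem

variable {n m : ℕ} {P : ControlProblem n m} {S : Set (Euc n)}

/-- The part of the Lagrangian that depends on the sink, beyond its prescribed interior part. -/
def boundaryCost (P : ControlProblem n m) (p : DensityDecision n m) (μ : Euc n → ℝ) : ℝ :=
  ∫ x in frontier P.target, (P.D x - μ x) ∂p.sink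

theorem boundaryCost_nonneg {p : DensityDecision n m} {μ : Euc n → ℝ}
    (h : ∀ x ∈ frontier P.target, μ x ≤ P.D x) : 0 ≤ P.boundaryCost p μ :=
  setIntegral_nonneg isClosed_frontier.measurableSet fun x hx => sub_nonneg.2 (h x hx)

namespace IsRegular

variable (hP : P.IsRegular S)
include hP

omit hP in
theorem integrable_rho_mul_hamiltonian {p : DensityDecision n m} (hp : P.IsDensityDecision p)
    {μ : Euc n → ℝ} (hμ : LocallyLipschitz μ) :
    Integrable fun x => p.rho x * P.hamiltonian μ x (p.u x) := by
  refine ((integrable_flux hp hμ).add hp.cost_integrable).congr (ae_of_all _ fun x => ?_)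
  simp [hamiltonian, closedLoop, closedLoopCost, mul_add]

theorem integral_sink_eq {p : DensityDecision n m} (hp : P.IsDensityDecision p)
    {ψ : Euc n → ℝ} (hψ : ContinuousOn ψ P.target) :
    ∫ x, ψ x ∂p.sink =
      (∫ x in interior P.target, ψ x * P.supply x) + ∫ x in frontier P.target, ψ x ∂p.sink := by
  have hi := hP.integrable_sink hp hψ
  have hunion : P.target = interior P.target ∪ frontier P.target := by
    rw [← closure_eq_interior_union_frontier, hP.isClosed_target.closure_eq]
  rw [← restrict_sink hp]
  conv_lhs => rw [hunion]
  rw [restrict_sink hp, setIntegral_union disjoint_interior_frontier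
    isClosed_frontier.measurableSet hi.integrableOn hi.integrableOn, hp.sink_interior,
    integral_withDensity_eq_integral_toReal_smul₀
      hP.integrable_supply.1.aemeasurable.ennreal_ofReal.restrict
      (ae_of_all _ fun _ => ENNReal.ofReal_lt_top)]
  congr 1
  refine integral_congr_ae (ae_of_all _ fun x => ?_)
  simp [ENNReal.toReal_ofReal (hP.supply_nonneg x), mul_comm]

theorem valueObjective_valueExtension {μ : Euc n → ℝ} (hμ : Continuous μ) :
    P.valueObjective (P.valueExtension μ) = (∫ x, μ x * P.supply x) +
      ∫ x in interior P.target, (P.D x - μ x) * P.supply x := by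
  have h1 : IntegrableOn (fun x => (P.D x - μ x) * P.supply x) (interior P.target) :=
    (hP.integrableOn_target_supply_mul (hP.continuousOn_D.sub hμ.continuousOn)).mono_set
      interior_subset
  rw [← integral_indicator isOpen_interior.measurableSet, ← integral_add
    (hP.integrable_supply_mul hμ) ((integrable_indicator_iff
      isOpen_interior.measurableSet).2 h1), valueObjective]
  refine integral_congr_ae (ae_of_all _ fun x => ?_)
  by_cases hx : x ∈ interior P.target
  · simp only [valueExtension, hx, piecewise_eq_of_mem, indicator_of_mem]; ring
  · simp only [valueExtension, hx, not_false_eq_true, piecewise_eq_of_notMem,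
      indicator_of_notMem]; ring

/-- The Lagrangian splits into the dual objective, a running term and a boundary term. -/
theorem lagrangian_eq {p : DensityDecision n m} (hp : P.IsDensityDecision p)
    {μ : Euc n → ℝ} (hμ : LocallyLipschitz μ) :
    P.lagrangian p μ = (∫ x, p.rho x * P.hamiltonian μ x (p.u x)) + P.boundaryCost p μ +
      P.valueObjective (P.valueExtension μ) := by
  have hc := hμ.continuous
  have e1 : ∫ x, p.rho x * P.hamiltonian μ x (p.u x) =
      (∫ x, p.rho x * fderiv ℝ μ x (P.closedLoop p.u x)) +
        ∫ x, p.rho x * P.closedLoopCost p.u x := by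
    rw [← integral_add (integrable_flux hp hμ) hp.cost_integrable]
    simp [hamiltonian, closedLoop, closedLoopCost, mul_add]
  -- On the interior the sink is φ₊ dx, so D - μ integrates there to exactly the correction that
  -- turns ∫ μφ₊ into ⟨φ₊, V_μ⟩.
  have e2 := hP.integral_sink_eq hp (hP.continuousOn_D.sub hc.continuousOn)
  have e3 : ∫ x, (P.D - μ) x ∂p.sink = (∫ x, P.D x ∂p.sink) - ∫ x, μ x ∂p.sink :=
    integral_sub (hP.integrable_sink hp hP.continuousOn_D) (hP.integrable_sink hp hc.continuousOn)
  rw [hP.valueObjective_valueExtension hc, e1, lagrangian, densityCost, liouvillePairing,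
    boundaryCost]
  simp only [Pi.sub_apply] at e2 e3
  linarith

/-- A constant strategy with a compactly supported density and an arbitrary finite sink on the
boundary of the target is a decision. -/
theorem isDensityDecision_of_frontier {v : Euc m} (hv : v ∈ P.controlSet) {ρ : Euc n → ℝ}
    (hρ : ∀ x, 0 ≤ ρ x) (hρm : Integrable ρ) (hρc : HasCompactSupport ρ)
    (hρt : ∀ x ∈ P.target, ρ x = 0) {σ : Measure (Euc n)} [IsFiniteMeasure σ]
    (hσ : σ (frontier P.target)ᶜ = 0) :
    P.IsDensityDecision ⟨ρ, fun _ => v, (volume.restrict (interior P.target)).withDensity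
      (fun x => ENNReal.ofReal (P.supply x)) + σ⟩ where
  measurable_u := measurable_const
  u_mem _ := hv
  rho_nonneg := hρ
  rho_integrable := hρm
  rho_compact := hρc
  rho_target := hρt
  flux_integrable := by
    have h : IntegrableOn (fun x => ρ x • P.F x v) (tsupport ρ) :=
      hρm.integrableOn.smul_continuousOn (hP.continuous_F hv).continuousOn hρc
    exact h.integrable_of_forall_notMem_eq_zero fun x hx => by
      simp [image_eq_zero_of_notMem_tsupport hx]
  cost_integrable := by
    have h : IntegrableOn (fun x => ρ x • P.C x v) (tsupport ρ) :=
      hρm.integrableOn.smul_continuousOn (hP.continuous_C hv).continuousOn hρc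
    exact h.integrable_of_forall_notMem_eq_zero fun x hx => by
      simp [image_eq_zero_of_notMem_tsupport hx]
  sink_finite := by
    have : IsFiniteMeasure ((volume.restrict (interior P.target)).withDensity
      (fun x => ENNReal.ofReal (P.supply x))) :=
      isFiniteMeasure_withDensity_ofReal hP.integrable_supply.integrableOn.2
    change IsFiniteMeasure (_ + _)
    infer_instance
  sink_compl := by
    have h1 : (volume.restrict (interior P.target)) P.targetᶜ = 0 := by
      rw [Measure.restrict_apply hP.isClosed_target.measurableSet.compl]
      have : P.targetᶜ ∩ interior P.target = ∅ := by
        ext x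
        simp only [mem_inter_iff, mem_compl_iff, mem_empty_iff_false, iff_false, not_and]
        exact fun hx hx' => hx (interior_subset hx')
      simp [this]
    rw [Measure.add_apply, withDensity_absolutelyContinuous _ _ h1, zero_add]
    exact measure_mono_null (compl_subset_compl.2 hP.isClosed_target.frontier_subset) hσ
  sink_interior := by
    rw [Measure.restrict_add, restrict_withDensity isOpen_interior.measurableSet,
      Measure.restrict_restrict isOpen_interior.measurableSet, inter_self]
    have : σ.restrict (interior P.target) = 0 := by
      rw [Measure.restrict_eq_zero]
      refine measure_mono_null (fun x hx => ?_) hσ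
      exact disjoint_left.1 disjoint_interior_frontier hx
    rw [this, add_zero]

omit hP in
theorem boundaryCost_add {v : Euc m} {ρ : Euc n → ℝ} {σ : Measure (Euc n)}
    (hσ : σ (frontier P.target)ᶜ = 0) (μ : Euc n → ℝ) :
    P.boundaryCost ⟨ρ, fun _ => v, (volume.restrict (interior P.target)).withDensity
      (fun x => ENNReal.ofReal (P.supply x)) + σ⟩ μ = ∫ x, (P.D x - μ x) ∂σ := by
  have h0 : ((volume.restrict (interior P.target)).withDensity
      (fun x => ENNReal.ofReal (P.supply x))).restrict (frontier P.target) = 0 := by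
    rw [Measure.restrict_eq_zero]
    refine withDensity_absolutelyContinuous _ _ ?_
    rw [Measure.restrict_apply isClosed_frontier.measurableSet,
      (disjoint_interior_frontier.symm).inter_eq, measure_empty]
  rw [boundaryCost, Measure.restrict_add, h0, zero_add, Measure.restrict_eq_self_of_ae_mem]
  exact hσ

theorem lagrangian_ge {p : DensityDecision n m} (hp : P.IsDensityDecision p) {μ : Euc n → ℝ}
    (hμ : μ ∈ P.multipliers) (hs : P.IsSubsolution μ) :
    P.valueObjective (P.valueExtension μ) ≤ P.lagrangian p μ := by
  have h1 : 0 ≤ ∫ x, p.rho x * P.hamiltonian μ x (p.u x) :=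
    integral_nonneg (rho_mul_hamiltonian_nonneg hp fun v hv x hx =>
      hP.hamiltonian_nonneg hμ hv (hs.1 v hv) hx)
  have h2 := boundaryCost_nonneg (p := p) hs.2
  rw [hP.lagrangian_eq hp hμ.1]
  linarith

theorem dualFunction_of_isSubsolution {μ : Euc n → ℝ} (hμ : μ ∈ P.multipliers)
    (hs : P.IsSubsolution μ) :
    P.dualFunction μ = ((P.valueObjective (P.valueExtension μ) : ℝ) : EReal) := by
  refine le_antisymm ?_ (le_iInf₂ fun p hp => EReal.coe_le_coe_iff.2 (hP.lagrangian_ge hp hμ hs))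
  obtain ⟨v, hv⟩ := hP.nonempty
  -- With zero density and no boundary sink both nonnegative terms vanish, so the lower bound is
  -- attained.
  have hp := hP.isDensityDecision_of_frontier hv (ρ := fun _ => 0) (σ := 0) (fun _ => le_rfl)
    (integrable_zero _ _ _) HasCompactSupport.zero (fun _ _ => rfl) (by simp)
  refine (iInf₂_le _ hp).trans (EReal.coe_le_coe_iff.2 ?_)
  rw [hP.lagrangian_eq hp hμ.1, boundaryCost_add (by simp)]
  simp

/-- The Lagrangian is affine along a ray of decisions that puts mass k on the violation, as density
off the target or as a point sink on its boundary; the slope is negative. -/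
theorem dualFunction_of_not_isSubsolution {μ : Euc n → ℝ} (hμ : μ ∈ P.multipliers)
    (hs : ¬ P.IsSubsolution μ) : P.dualFunction μ = ⊥ := by
  rw [IsSubsolution, not_and_or] at hs
  push Not at hs
  rcases hs with ⟨v, hv, hA⟩ | ⟨x, hx, hD⟩
  · set A : Set (Euc n) := {x | x ∉ P.target ∧ P.hamiltonian μ x v < 0} with hAdef
    have hAm : MeasurableSet A := hP.isClosed_target.measurableSet.compl.inter
      (measurableSet_lt (hP.measurable_hamiltonian μ hv) measurable_const)
    have hA0 : volume A ≠ 0 := fun h0 => hA (by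
      rw [ae_iff]; convert! h0 using 2; ext x; simp [hAdef])
    -- Some bounded piece of the violation set already has positive measure; boundedness makes the
    -- density integrable and compactly supported.
    obtain ⟨N, hN⟩ : ∃ N : ℕ, volume (A ∩ Metric.ball 0 (N : ℝ)) ≠ 0 := by
      by_contra! hcon
      refine hA0 (measure_mono_null (fun x hx => ?_) (measure_iUnion_null hcon))
      obtain ⟨N, hN⟩ := exists_nat_gt ‖x‖
      exact mem_iUnion.2 ⟨N, hx, by simpa using hN⟩
    set B := A ∩ Metric.ball 0 (N : ℝ)
    have hBm : MeasurableSet B := hAm.inter Metric.isOpen_ball.measurableSet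
    have hBfin : volume B ≠ ⊤ :=
      ((measure_mono inter_subset_right).trans_lt Metric.isBounded_ball.measure_lt_top).ne
    set ρ : ℕ → Euc n → ℝ := fun k => B.indicator fun _ => (k : ℝ) with hρ
    have hdec := fun k : ℕ => hP.isDensityDecision_of_frontier hv (ρ := ρ k) (σ := 0)
      (fun x => indicator_nonneg (fun _ _ => k.cast_nonneg) x)
      ((integrable_indicator_iff hBm).2 (integrableOn_const hBfin))
      (HasCompactSupport.of_support_subset_isCompact (isCompact_closedBall (0 : Euc n) N)
        fun x hx => Metric.ball_subset_closedBall (support_indicator_subset hx).2)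
      (fun x hx => indicator_of_notMem (fun h => h.1.1 hx) _) (by simp)
    have hval : ∀ k : ℕ, ∀ x, ρ k x * P.hamiltonian μ x v =
        k * B.indicator (fun x => P.hamiltonian μ x v) x := fun k x => by
      by_cases hx : x ∈ B <;> simp [hρ, hx]
    have hint : Integrable (B.indicator fun x => P.hamiltonian μ x v) := by
      have := integrable_rho_mul_hamiltonian (hdec 1) hμ.1
      simpa [hval] using this
    refine EReal.eq_bot_of_forall_nat_mul_add (a := ∫ x, B.indicator (P.hamiltonian μ · v) x)
      (b := P.valueObjective (P.valueExtension μ)) ?_ fun k => ?_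
    · have hle : ∀ x, 0 ≤ -B.indicator (fun x => P.hamiltonian μ x v) x := fun x => by
        by_cases hx : x ∈ B
        · simpa [hx] using hx.1.2.le
        · simp [hx]
      have hpos := (integral_pos_iff_support_of_nonneg hle hint.neg).2
        ((pos_iff_ne_zero.2 hN).trans_le (measure_mono fun x hx => by
          simpa [hx] using hx.1.2.ne))
      rw [integral_neg] at hpos
      linarith
    · refine (iInf₂_le _ (hdec k)).trans (EReal.coe_le_coe_iff.2 ?_)
      rw [hP.lagrangian_eq (hdec k) hμ.1, boundaryCost_add (by simp)]
      simp [hval, integral_const_mul]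
  · have hσ : ∀ k : ℕ, ((k : NNReal) • Measure.dirac x) (frontier P.target)ᶜ = 0 := fun k => by
      rw [Measure.smul_apply, Measure.dirac_apply' _ isClosed_frontier.measurableSet.compl]
      simp [hx]
    have hdec := fun k : ℕ => hP.isDensityDecision_of_frontier hP.nonempty.choose_spec
      (ρ := fun _ => 0) (σ := (k : NNReal) • Measure.dirac x) (fun _ => le_rfl)
      (integrable_zero _ _ _) HasCompactSupport.zero (fun _ _ => rfl) (hσ k)
    refine EReal.eq_bot_of_forall_nat_mul_add (a := P.D x - μ x)
      (b := P.valueObjective (P.valueExtension μ)) (sub_neg.2 hD) fun k => ?_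
    refine (iInf₂_le _ (hdec k)).trans (EReal.coe_le_coe_iff.2 ?_)
    rw [hP.lagrangian_eq (hdec k) hμ.1, boundaryCost_add (hσ k), integral_smul_nnreal_measure,
      integral_dirac]
    simp [NNReal.smul_def]

theorem iSup_lagrangian_of_isStationary {p : DensityDecision n m} (hp : P.IsDensityDecision p)
    (hs : P.IsStationary p) :
    (⨆ μ ∈ P.multipliers, ((P.lagrangian p μ : ℝ) : EReal)) = ((P.densityCost p : ℝ) : EReal) := by
  have h : ∀ μ ∈ P.multipliers, P.lagrangian p μ = P.densityCost p := fun μ hμ => by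
    rw [lagrangian, hP.liouvillePairing_eq_zero hp hs hμ.1, add_zero]
  refine le_antisymm (iSup₂_le fun μ hμ => (congrArg _ (h μ hμ)).le) ?_
  have h0 : (fun _ => 0 : Euc n → ℝ) ∈ P.multipliers :=
    ⟨(LipschitzWith.const 0).locallyLipschitz, fun _ _ => differentiableAt_const _⟩
  exact (congrArg _ (h _ h0)).ge.trans
    (le_iSup₂ (f := fun μ _ => ((P.lagrangian p μ : ℝ) : EReal)) _ h0)

omit hP in
theorem iSup_lagrangian_of_not_isStationary {p : DensityDecision n m} (hs : ¬ P.IsStationary p) :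
    (⨆ μ ∈ P.multipliers, ((P.lagrangian p μ : ℝ) : EReal)) = ⊤ := by
  rw [IsStationary] at hs
  push Not at hs
  obtain ⟨ψ, hψ, -, h0⟩ := hs
  have hd : Differentiable ℝ ψ := hψ.differentiable (by simp)
  have hmem : ∀ c : ℝ, (fun x => c * ψ x) ∈ P.multipliers := fun c =>
    ⟨((contDiff_const.mul hψ).of_le (by exact_mod_cast le_top) : ContDiff ℝ 1 _).locallyLipschitz,
      fun x _ => (hd x).const_mul c⟩
  have hlin : ∀ c : ℝ, P.liouvillePairing p (fun x => c * ψ x) = c * P.liouvillePairing p ψ := by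
    intro c
    have h1 : ∀ x, c * ψ x * P.supply x = c * (ψ x * P.supply x) := fun x => mul_assoc _ _ _
    have h2 : ∀ x, p.rho x * fderiv ℝ (fun x => c * ψ x) x (P.closedLoop p.u x) =
        c * (p.rho x * fderiv ℝ ψ x (P.closedLoop p.u x)) := fun x => by
      rw [fderiv_const_mul (hd x)]
      simp only [FunLike.coe_smul, Pi.smul_apply, smul_eq_mul]
      ring
    simp only [liouvillePairing, h1, h2, integral_const_mul]
    ring
  refine (EReal.eq_top_iff_forall_lt _).2 fun y => ?_
  -- The test function is scaled so that the Lagrangian equals y + 1.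
  have hle := le_iSup₂ (f := fun μ (_ : μ ∈ P.multipliers) => ((P.lagrangian p μ : ℝ) : EReal)) _
    (hmem ((y + 1 - P.densityCost p) / P.liouvillePairing p ψ))
  refine lt_of_lt_of_le (EReal.coe_lt_coe_iff.2 ?_) hle
  rw [lagrangian, hlin, div_mul_cancel₀ _ h0]
  linarith

end IsRegular

end ControlProblem

/-! ### Comparison along optimal trajectories and complementary slackness. -/

namespace ControlProblem

variable {n m : ℕ} {P : ControlProblem n m} {S : Set (Euc n)}

namespace IsTrajectory

variable {u : Euc n → Euc m} {x : Euc n} {T : ℝ} {γ : ℝ → Euc n}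

theorem time_pos (h : P.IsTrajectory u S x T γ) (hx : x ∉ P.target) : 0 < T := by
  refine lt_of_le_of_ne h.time_nonneg fun h0 => hx ?_
  have := h.arrival
  rwa [← h0, h.start] at this

theorem time_eq_zero (h : P.IsTrajectory u S x T γ) (hx : x ∈ P.target) : T = 0 := by
  by_contra h0
  have := h.before 0 ⟨le_rfl, lt_of_le_of_ne h.time_nonneg (Ne.symm h0)⟩
  rw [h.start] at this
  exact this hx

theorem tendsto_left (h : P.IsTrajectory u S x T γ) {t : ℝ} (h0 : 0 < t) (ht : t ≤ T) :
    Tendsto γ (𝓝[<] t) (𝓝 (γ t)) := by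
  rw [← nhdsWithin_Ico_eq_nhdsLT h0]
  exact (h.continuousOn t ⟨h0.le, ht⟩).mono fun s hs => ⟨hs.1, hs.2.le.trans ht⟩

theorem arrival_mem_frontier (h : P.IsTrajectory u S x T γ) (hx : x ∉ P.target) :
    γ T ∈ frontier P.target := by
  rw [frontier_eq_closure_inter_closure]
  have hT := h.time_pos hx
  refine ⟨subset_closure h.arrival, mem_closure_of_tendsto (h.tendsto_left hT le_rfl) ?_⟩
  filter_upwards [Ico_mem_nhdsLT hT] with t ht using h.before t ht

theorem hasDerivAt_comp (h : P.IsTrajectory u S x T γ) {μ : Euc n → ℝ} (hμ : μ ∈ P.multipliers)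
    {t : ℝ} (ht : t ∈ Ioo 0 T) :
    HasDerivAt (fun s => μ (γ s)) (fderiv ℝ μ (γ t) (P.closedLoop u (γ t))) t :=
  (hμ.2 _ (h.before t ⟨ht.1.le, ht.2⟩)).hasFDerivAt.comp_hasDerivAt t (h.ode t ht)

theorem continuousOn_comp (h : P.IsTrajectory u S x T γ) {μ : Euc n → ℝ} (hμ : μ ∈ P.multipliers) :
    ContinuousOn (fun s => μ (γ s)) (Icc 0 T) :=
  hμ.1.continuous.comp_continuousOn h.continuousOn

end IsTrajectory

namespace IsHJBSolution

variable {V : Euc n → ℝ} {u : Euc n → Euc m}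

theorem hamiltonian_nonneg (h : P.IsHJBSolution V u) {x : Euc n} (hx : x ∉ P.target) {v : Euc m}
    (hv : v ∈ P.controlSet) : 0 ≤ P.hamiltonian V x v := by
  have h1 : P.hamiltonian V x (u x) ≤ P.hamiltonian V x v := h.argmin x hx hv
  have h2 : P.hamiltonian V x (u x) = 0 := by rw [← h.hjb x hx]; exact add_comm _ _
  exact h2 ▸ h1

theorem isSubsolution (hc : IsClosed P.target) (h : P.IsHJBSolution V u) : P.IsSubsolution V :=
  ⟨fun _ hv => ae_of_all _ fun _ hx => h.hamiltonian_nonneg hx hv,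
    fun x hx => (h.terminal x (hc.frontier_subset hx)).le⟩

theorem valueExtension_eq (h : P.IsHJBSolution V u) : P.valueExtension V = V := by
  ext x
  by_cases hx : x ∈ interior P.target
  · simp [valueExtension, hx, h.terminal x (interior_subset hx)]
  · simp [valueExtension, hx]

/-- Comparison principle along a trajectory of the optimal closed loop. -/
theorem le_of_isTrajectory (h : P.IsHJBSolution V u) {μ : Euc n → ℝ} (hμ : μ ∈ P.multipliers)
    (hle : ∀ x ∉ P.target, ∀ v ∈ P.controlSet, 0 ≤ P.hamiltonian μ x v)
    (hfr : ∀ x ∈ frontier P.target, μ x ≤ P.D x) {x : Euc n} {T : ℝ} {γ : ℝ → Euc n}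
    (hγ : P.IsTrajectory u S x T γ) (hx : x ∉ P.target) : μ x ≤ V x := by
  have hder : ∀ t ∈ Ioo 0 T, HasDerivAt (fun s => V (γ s) - μ (γ s))
      (fderiv ℝ V (γ t) (P.closedLoop u (γ t)) - fderiv ℝ μ (γ t) (P.closedLoop u (γ t))) t :=
    fun t ht => (hγ.hasDerivAt_comp h.regular ht).sub (hγ.hasDerivAt_comp hμ ht)
  -- Along the trajectory V has derivative exactly -C, while the derivative of μ is at least -C.
  have hanti : AntitoneOn (fun s => V (γ s) - μ (γ s)) (Icc 0 T) := by
    refine antitoneOn_of_deriv_nonpos (convex_Icc 0 T)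
      ((hγ.continuousOn_comp h.regular).sub (hγ.continuousOn_comp hμ)) ?_ ?_
    · rw [interior_Icc]
      exact fun t ht => (hder t ht).differentiableAt.differentiableWithinAt
    · rw [interior_Icc]
      intro t ht
      have hout := hγ.before t ⟨ht.1.le, ht.2⟩
      have h1 := h.hjb _ hout
      have h2 : 0 ≤ fderiv ℝ μ (γ t) (P.closedLoop u (γ t)) + P.closedLoopCost u (γ t) :=
        hle _ hout _ (h.u_mem _)
      rw [(hder t ht).deriv]
      linarith
  have hT := hγ.time_nonneg
  have h1 : V (γ T) - μ (γ T) ≤ V (γ 0) - μ (γ 0) := hanti ⟨le_rfl, hT⟩ ⟨hT, le_rfl⟩ hT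
  have h2 := hfr _ (hγ.arrival_mem_frontier hx)
  rw [hγ.start, h.terminal _ hγ.arrival] at h1
  linarith

end IsHJBSolution

namespace IsRegular

variable (hP : P.IsRegular S)
include hP

theorem integrable_supply_mul_valueExtension {μ : Euc n → ℝ} (hμ : Continuous μ) :
    Integrable fun x => P.supply x * P.valueExtension μ x := by
  classical
  have h1 : IntegrableOn (fun x => P.D x * P.supply x) (interior P.target) :=
    (hP.integrableOn_target_supply_mul hP.continuousOn_D).mono_set interior_subset
  have h2 : IntegrableOn (fun x => μ x * P.supply x) (interior P.target)ᶜ :=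
    (hP.integrable_supply_mul hμ).integrableOn
  refine (Integrable.piecewise isOpen_interior.measurableSet h1 h2).congr
    (ae_of_all _ fun x => ?_)
  by_cases hx : x ∈ interior P.target <;> simp [valueExtension, hx, mul_comm]

/-- The comparison is pointwise on S: equality in the interior of the target, the boundary condition
on its frontier, and the trajectory argument outside. -/
theorem valueObjective_valueExtension_le {V : Euc n → ℝ} {u : Euc n → Euc m} {τ : Euc n → ℝ}
    (h : P.IsHJBSolution V u) (hA : P.IsAbsorbing u S τ) {μ : Euc n → ℝ} (hμ : μ ∈ P.multipliers)
    (hs : P.IsSubsolution μ) :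
    P.valueObjective (P.valueExtension μ) ≤ P.valueObjective V := by
  have hint := hP.integrable_supply_mul_valueExtension h.regular.1.continuous
  rw [h.valueExtension_eq] at hint
  refine integral_mono (hP.integrable_supply_mul_valueExtension hμ.1.continuous) hint fun x => ?_
  by_cases hxS : x ∈ S
  swap
  · simp [hP.supply_eq_zero x hxS]
  refine mul_le_mul_of_nonneg_left ?_ (hP.supply_nonneg x)
  by_cases hi : x ∈ interior P.target
  · simp [valueExtension, hi, h.terminal x (interior_subset hi)]
  simp only [valueExtension, hi, not_false_eq_true, piecewise_eq_of_notMem]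
  by_cases hx : x ∈ P.target
  · rw [h.terminal x hx]
    refine hs.2 x ?_
    rw [hP.isClosed_target.frontier_eq]
    exact ⟨hx, hi⟩
  · obtain ⟨γ, hγ⟩ := hA.trajectory x hxS
    exact h.le_of_isTrajectory hμ (fun y hy v hv => hP.hamiltonian_nonneg hμ hv (hs.1 v hv) hy)
      hs.2 hγ hx

theorem dualFunction_of_isHJBSolution {V : Euc n → ℝ} {u : Euc n → Euc m}
    (h : P.IsHJBSolution V u) : P.dualFunction V = ((P.valueObjective V : ℝ) : EReal) := by
  rw [hP.dualFunction_of_isSubsolution h.regular (h.isSubsolution hP.isClosed_target),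
    h.valueExtension_eq]

theorem dualFunction_le {V : Euc n → ℝ} {u : Euc n → Euc m} {τ : Euc n → ℝ}
    (h : P.IsHJBSolution V u) (hA : P.IsAbsorbing u S τ) {μ : Euc n → ℝ}
    (hμ : μ ∈ P.multipliers) : P.dualFunction μ ≤ P.dualFunction V := by
  by_cases hs : P.IsSubsolution μ
  · rw [hP.dualFunction_of_isHJBSolution h, hP.dualFunction_of_isSubsolution hμ hs]
    exact EReal.coe_le_coe_iff.2 (hP.valueObjective_valueExtension_le h hA hμ hs)
  · rw [hP.dualFunction_of_not_isSubsolution hμ hs]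
    exact bot_le

/-- Complementary slackness for a stationary decision and a multiplier with equal values. -/
theorem complementary_slackness {p : DensityDecision n m} (hp : P.IsDensityDecision p)
    (hst : P.IsStationary p) {μ : Euc n → ℝ} (hμ : μ ∈ P.multipliers) (hs : P.IsSubsolution μ)
    (hval : P.densityCost p = P.valueObjective (P.valueExtension μ)) :
    (∀ᵐ x, 0 < p.rho x → IsMinOn (P.hamiltonian μ x) P.controlSet (p.u x) ∧
      P.closedLoopCost p.u x + fderiv ℝ μ x (P.closedLoop p.u x) = 0) ∧
    ∀ᵐ x ∂p.sink, x ∈ frontier P.target → μ x = P.D x := by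
  have hle : ∀ v ∈ P.controlSet, ∀ x ∉ P.target, 0 ≤ P.hamiltonian μ x v :=
    fun v hv x hx => hP.hamiltonian_nonneg hμ hv (hs.1 v hv) hx
  have hnn := rho_mul_hamiltonian_nonneg hp hle
  have h1 : 0 ≤ ∫ x, p.rho x * P.hamiltonian μ x (p.u x) := integral_nonneg hnn
  have h2 := boundaryCost_nonneg (p := p) hs.2
  have h3 := hP.lagrangian_eq hp hμ.1
  -- Stationarity reduces the Lagrangian to the cost, which equals the dual objective; the two
  -- nonnegative remainders therefore sum to zero.
  rw [lagrangian, hP.liouvillePairing_eq_zero hp hst hμ.1] at h3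
  constructor
  · have h0 := (integral_eq_zero_iff_of_nonneg hnn (integrable_rho_mul_hamiltonian hp hμ.1)).1
      (by linarith)
    filter_upwards [h0] with x hx hpos
    have hx0 : P.hamiltonian μ x (p.u x) = 0 := (mul_eq_zero.1 hx).resolve_left hpos.ne'
    have hxt : x ∉ P.target := fun h => hpos.ne' (hp.rho_target x h)
    refine ⟨fun v hv => ?_, ?_⟩
    · rw [mem_ofPred_eq, hx0]
      exact hle v hv x hxt
    · rw [← hx0]
      exact add_comm _ _
  · have hi : IntegrableOn (fun x => P.D x - μ x) (frontier P.target) p.sink :=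
      (hP.integrable_sink hp (hP.continuousOn_D.sub hμ.1.continuous.continuousOn)).integrableOn
    have h0 := (setIntegral_eq_zero_iff_of_nonneg_ae
      ((ae_restrict_iff' isClosed_frontier.measurableSet).2
        (ae_of_all _ fun x hx => sub_nonneg.2 (hs.2 x hx))) hi).1
      (show P.boundaryCost p μ = 0 by linarith)
    filter_upwards [(ae_restrict_iff' isClosed_frontier.measurableSet).1 h0] with x hx hxf
    have h4 : P.D x - μ x = 0 := hx hxf
    linarith

end IsRegular

end ControlProblem

/-! ### Gronwall estimates, measurability of the flow, and preservation of null sets. -/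

/-- A set of finite-dimensional vectors is null if some map that does not contract distances on it
too much sends it to a null set. -/
theorem volume_eq_zero_of_dist_le_mul {n : ℕ} {h : Euc n → Euc n} {A B : Set (Euc n)} {K : ℝ}
    (hK : 0 ≤ K) (hexp : ∀ x ∈ B, ∀ y ∈ B, dist x y ≤ K * dist (h x) (h y))
    (hBA : MapsTo h B A) (hA : volume A = 0) : volume B = 0 := by
  have hinj : InjOn h B := fun x hx y hy hxy => by
    have := hexp x hx y hy
    rw [hxy, dist_self, mul_zero] at this
    exact dist_le_zero.1 this
  have hL : LipschitzOnWith ⟨K, hK⟩ (Function.invFunOn h B) (h '' B) := by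
    refine LipschitzOnWith.of_dist_le_mul ?_
    rintro _ ⟨x, hx, rfl⟩ _ ⟨y, hy, rfl⟩
    rw [hinj.leftInvOn_invFunOn hx, hinj.leftInvOn_invFunOn hy]
    exact hexp x hx y hy
  -- Hausdorff measure in full dimension has the same null sets as volume and is controlled under
  -- Lipschitz maps on arbitrary sets, so `B` need not be measurable.
  have hAH : Measure.hausdorffMeasure (Module.finrank ℝ (Euc n)) A = 0 :=
    Measure.absolutelyContinuous_isAddHaarMeasure _ (volume : Measure (Euc n)) hA
  have hle := hL.hausdorffMeasure_image_le (d := (Module.finrank ℝ (Euc n))) (by positivity)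
  rw [measure_mono_null hBA.image_subset hAH, mul_zero, hinj.leftInvOn_invFunOn.image_image] at hle
  exact Measure.absolutelyContinuous_isAddHaarMeasure (volume : Measure (Euc n))
    (Measure.hausdorffMeasure (Module.finrank ℝ (Euc n))) (nonpos_iff_eq_zero.1 hle)

namespace ControlProblem

variable {n m : ℕ} {P : ControlProblem n m} {S : Set (Euc n)} {u : Euc n → Euc m}
  {τ : Euc n → ℝ} {Γ : Euc n → ℝ → Euc n}

/-- The states in `S` at distance at least `1 / (j + 1)` from the target. -/
def core (P : ControlProblem n m) (S : Set (Euc n)) (j : ℕ) : Set (Euc n) :=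
  {x ∈ S | 1 / ((j : ℝ) + 1) ≤ Metric.infDist x P.target}

theorem core_subset_compl (j : ℕ) : P.core S j ⊆ P.targetᶜ := fun x hx hxt => by
  have h1 : (0 : ℝ) < 1 / ((j : ℝ) + 1) := by positivity
  have h2 := hx.2
  rw [Metric.infDist_zero_of_mem hxt] at h2
  exact h2.not_gt h1

theorem core_mono : Monotone (P.core S) := fun _ _ hij _ hx =>
  ⟨hx.1, (one_div_le_one_div_of_le (by positivity) (by gcongr)).trans hx.2⟩

theorem isCompact_core (hS : IsCompact S) (j : ℕ) : IsCompact (P.core S j) :=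
  hS.inter_right (isClosed_le continuous_const (Metric.continuous_infDist_pt _))

/-- The field is only locally Lipschitz off the target; compact cores supply the uniform constants
that Gronwall needs. -/
theorem IsAbsorbing.exists_lipschitzOnWith_core (hA : P.IsAbsorbing u S τ) (hS : IsCompact S)
    (j : ℕ) : ∃ K, LipschitzOnWith K (P.closedLoop u) (P.core S j) :=
  (hA.lipschitz.mono (core_subset_compl j)).exists_lipschitzOnWith_of_compact (isCompact_core hS j)

theorem IsAbsorbing.continuousOn_closedLoop (hA : P.IsAbsorbing u S τ) :
    ContinuousOn (P.closedLoop u) P.targetᶜ := hA.lipschitz.continuousOn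

namespace IsTrajectory

variable {x y : Euc n} {T T' : ℝ} {γ η : ℝ → Euc n}

/-- The ODE is imposed on the open interval, but Gronwall also needs a right derivative at time 0;
it is the limit of the derivatives, by continuity of the field off the target. -/
theorem hasDerivWithinAt (h : P.IsTrajectory u S x T γ) (hc : IsClosed P.target)
    (hF : ContinuousOn (P.closedLoop u) P.targetᶜ) {t : ℝ} (ht : t ∈ Ico 0 T) :
    HasDerivWithinAt γ (P.closedLoop u (γ t)) (Ici t) t := by
  have hT : t < T := ht.2
  have hsub : Ioo t T ⊆ Ioo 0 T := Ioo_subset_Ioo_left ht.1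
  have hmem : Ioo t T ∈ 𝓝[>] t := Ioo_mem_nhdsGT hT
  have hcont : ContinuousWithinAt γ (Ioo t T) t :=
    (h.continuousOn t ⟨ht.1, ht.2.le⟩).mono (hsub.trans Ioo_subset_Icc_self)
  refine hasDerivWithinAt_Ici_of_tendsto_deriv
    (fun s hs => (h.ode s (hsub hs)).differentiableAt.differentiableWithinAt) hcont hmem ?_
  have h1 : Tendsto γ (𝓝[>] t) (𝓝 (γ t)) := by
    rw [← nhdsWithin_Ioo_eq_nhdsGT hT]; exact hcont
  have h2 : ContinuousAt (P.closedLoop u) (γ t) :=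
    hF.continuousAt (hc.isOpen_compl.mem_nhds (h.before t ht))
  refine (h2.tendsto.comp h1).congr' ?_
  filter_upwards [hmem] with s hs using (h.ode s (hsub hs)).deriv.symm

theorem dist_le_mul_abs_sub (h : P.IsTrajectory u S x T γ) (hc : IsClosed P.target)
    (hF : ContinuousOn (P.closedLoop u) P.targetᶜ) {M : ℝ}
    (hM : ∀ z ∈ S \ P.target, ‖P.closedLoop u z‖ ≤ M) {s t : ℝ} (hs : 0 ≤ s) (hst : s ≤ t)
    (ht : t ≤ T) : dist (γ t) (γ s) ≤ M * (t - s) := by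
  rw [dist_eq_norm]
  refine norm_image_sub_le_of_norm_deriv_right_le_segment
    (h.continuousOn.mono (Icc_subset_Icc hs ht))
    (fun r hr => h.hasDerivWithinAt hc hF ⟨hs.trans hr.1, hr.2.trans_le ht⟩)
    (fun r hr => hM _ ⟨h.invariant r ⟨hs.trans hr.1, hr.2.le.trans ht⟩,
      h.before r ⟨hs.trans hr.1, hr.2.trans_le ht⟩⟩) t ⟨hst, le_rfl⟩

theorem dist_le_forward (h : P.IsTrajectory u S x T γ) (h' : P.IsTrajectory u S y T' η)
    (hc : IsClosed P.target) (hF : ContinuousOn (P.closedLoop u) P.targetᶜ) {A : Set (Euc n)}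
    {K : NNReal} (hK : LipschitzOnWith K (P.closedLoop u) A) {t : ℝ} (h0 : 0 ≤ t) (hT : t ≤ T)
    (hT' : t ≤ T') (hA : ∀ s ∈ Icc 0 t, γ s ∈ A) (hA' : ∀ s ∈ Icc 0 t, η s ∈ A) :
    dist (γ t) (η t) ≤ dist x y * Real.exp (K * t) := by
  have := dist_le_of_trajectories_ODE_of_mem (v := fun _ => P.closedLoop u) (s := fun _ => A)
    (fun _ _ => hK) (h.continuousOn.mono (Icc_subset_Icc_right hT))
    (fun s hs => h.hasDerivWithinAt hc hF ⟨hs.1, hs.2.trans_le hT⟩)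
    (fun s hs => hA s ⟨hs.1, hs.2.le⟩) (h'.continuousOn.mono (Icc_subset_Icc_right hT'))
    (fun s hs => h'.hasDerivWithinAt hc hF ⟨hs.1, hs.2.trans_le hT'⟩)
    (fun s hs => hA' s ⟨hs.1, hs.2.le⟩) le_rfl t ⟨h0, le_rfl⟩
  simpa [h.start, h'.start] using this

/-- Gronwall in reversed time: the flow contracts distances at most by exp(-Kt). The strict
inequalities on `t` give the ODE at the starting time of the reversed motion. -/
theorem dist_le_backward (h : P.IsTrajectory u S x T γ) (h' : P.IsTrajectory u S y T' η)
    {A : Set (Euc n)} {K : NNReal} (hK : LipschitzOnWith K (P.closedLoop u) A) {t : ℝ}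
    (h0 : 0 ≤ t) (hT : t < T) (hT' : t < T') (hA : ∀ s ∈ Icc 0 t, γ s ∈ A)
    (hA' : ∀ s ∈ Icc 0 t, η s ∈ A) :
    dist x y ≤ dist (γ t) (η t) * Real.exp (K * t) := by
  have hmaps : ∀ R : ℝ, t < R → MapsTo (fun s : ℝ => t - s) (Icc 0 t) (Icc 0 R) := fun R hR s hs =>
    ⟨sub_nonneg.2 hs.2, by linarith [hs.1]⟩
  have hder : ∀ {z : Euc n} {R : ℝ} {ζ : ℝ → Euc n}, P.IsTrajectory u S z R ζ → t < R →
      ∀ s ∈ Ico 0 t, HasDerivWithinAt (fun s => ζ (t - s)) (-P.closedLoop u (ζ (t - s)))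
        (Ici s) s := fun {z R ζ} hζ hR s hs => by
    have h1 := (hζ.ode (t - s) ⟨sub_pos.2 hs.2, by linarith [hs.1]⟩).scomp s
      ((hasDerivAt_id s).const_sub t)
    rw [neg_one_smul] at h1
    exact h1.hasDerivWithinAt
  have hmem : ∀ s ∈ Ico 0 t, t - s ∈ Icc 0 t := fun s hs =>
    ⟨sub_nonneg.2 hs.2.le, by linarith [hs.1]⟩
  have := dist_le_of_trajectories_ODE_of_mem (v := fun _ z => -P.closedLoop u z) (s := fun _ => A)
    (K := K) (fun _ _ => LipschitzOnWith.neg hK)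
    (h.continuousOn.comp (continuous_const.sub continuous_id).continuousOn (hmaps T hT))
    (hder h hT) (fun s hs => hA _ (hmem s hs))
    (h'.continuousOn.comp (continuous_const.sub continuous_id).continuousOn (hmaps T' hT'))
    (hder h' hT') (fun s hs => hA' _ (hmem s hs)) le_rfl t ⟨h0, le_rfl⟩
  simpa [h.start, h'.start] using this

theorem exists_core (h : P.IsTrajectory u S x T γ) (hc : IsClosed P.target) {t : ℝ} (h0 : 0 ≤ t)
    (ht : t < T) : ∃ j, ∀ s ∈ Icc 0 t, γ s ∈ P.core S j := by
  have hne : P.target.Nonempty := ⟨_, h.arrival⟩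
  obtain ⟨s, hs, hmin⟩ := isCompact_Icc.exists_isMinOn (nonempty_Icc.2 h0)
    ((Metric.continuous_infDist_pt P.target).comp_continuousOn
      (h.continuousOn.mono (Icc_subset_Icc_right ht.le)))
  have hpos : 0 < Metric.infDist (γ s) P.target :=
    (hc.notMem_iff_infDist_pos hne).1 (h.before s ⟨hs.1, hs.2.trans_lt ht⟩)
  obtain ⟨j, hj⟩ := exists_nat_one_div_lt hpos
  exact ⟨j, fun r hr => ⟨h.invariant r ⟨hr.1, hr.2.trans ht.le⟩, hj.le.trans (hmin hr)⟩⟩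

end IsTrajectory

/-- The pairs of a time and an initial state in `S` whose trajectory has stayed in the `j`-th core
up to that time. -/
def staySet (P : ControlProblem n m) (S : Set (Euc n)) (τ : Euc n → ℝ) (Γ : Euc n → ℝ → Euc n)
    (j : ℕ) : Set (ℝ × Euc n) :=
  {z | z.2 ∈ S ∧ 0 ≤ z.1 ∧ z.1 < τ z.2 ∧ ∀ s ∈ Icc 0 z.1, Γ z.2 s ∈ P.core S j}

/-- The pairs of a time and an initial state in `S` that has not yet reached the target. -/
def activeSet (S : Set (Euc n)) (τ : Euc n → ℝ) : Set (ℝ × Euc n) :=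
  {z | z.2 ∈ S ∧ 0 ≤ z.1 ∧ z.1 < τ z.2}

/-- A choice of trajectories from all initial states in `S`. -/
def IsFlow (P : ControlProblem n m) (u : Euc n → Euc m) (S : Set (Euc n)) (τ : Euc n → ℝ)
    (Γ : Euc n → ℝ → Euc n) : Prop := ∀ x ∈ S, P.IsTrajectory u S x (τ x) (Γ x)

namespace IsFlow

variable (hΓ : P.IsFlow u S τ Γ) (hA : P.IsAbsorbing u S τ) (hc : IsClosed P.target)
  (hS : IsCompact S)

include hΓ hc in
theorem iUnion_staySet : ⋃ j, P.staySet S τ Γ j = activeSet S τ := by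
  ext z
  simp only [mem_iUnion, staySet, activeSet, mem_ofPred_eq]
  refine ⟨fun ⟨j, h1, h2, h3, _⟩ => ⟨h1, h2, h3⟩, fun ⟨h1, h2, h3⟩ => ?_⟩
  obtain ⟨j, hj⟩ := (hΓ _ h1).exists_core hc h2 h3
  exact ⟨j, h1, h2, h3, hj⟩

include hΓ hA hc hS

theorem isClosed_staySet (j : ℕ) : IsClosed (P.staySet S τ Γ j) := by
  have hF := hA.continuousOn_closedLoop
  refine IsSeqClosed.isClosed fun z w hz hw => ?_
  have hw1 : Tendsto (fun k => (z k).1) atTop (𝓝 w.1) := (continuous_fst.tendsto _).comp hw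
  have hw2 : Tendsto (fun k => (z k).2) atTop (𝓝 w.2) := (continuous_snd.tendsto _).comp hw
  have hwS : w.2 ∈ S := hS.isClosed.mem_of_tendsto hw2 (Eventually.of_forall fun k => (hz k).1)
  have hw0 : 0 ≤ w.1 := ge_of_tendsto' hw1 fun k => (hz k).2.1
  have hcl := (isCompact_core (P := P) hS j).isClosed
  have hTw := hΓ _ hwS
  have hstart : w.2 ∈ P.core S j := hcl.mem_of_tendsto hw2 (Eventually.of_forall fun k => by
    have := (hz k).2.2.2 0 ⟨le_rfl, (hz k).2.1⟩
    rwa [(hΓ _ (hz k).1).start] at this)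
  have hinner : ∀ r, 0 ≤ r → r < w.1 → r < τ w.2 → Γ w.2 r ∈ P.core S j := by
    intro r hr0 hrt hrT
    -- The limit trajectory is not yet known to stay in core `j`; it stays in some core `i`, and the
    -- larger of the two contains both trajectories.
    obtain ⟨i, hi⟩ := hTw.exists_core hc hr0 hrT
    obtain ⟨K, hK⟩ := hA.exists_lipschitzOnWith_core hS (max i j)
    have hlim : Tendsto (fun k => Γ (z k).2 r) atTop (𝓝 (Γ w.2 r)) := by
      rw [tendsto_iff_dist_tendsto_zero]
      have h0 : Tendsto (fun k => dist (z k).2 w.2 * Real.exp (K * r)) atTop (𝓝 0) := by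
        simpa using (tendsto_iff_dist_tendsto_zero.1 hw2).mul_const (Real.exp (K * r))
      refine squeeze_zero' (Eventually.of_forall fun k => dist_nonneg) ?_ h0
      filter_upwards [hw1.eventually_const_lt hrt] with k hk
      exact (hΓ _ (hz k).1).dist_le_forward hTw hc hF hK hr0 (hk.trans (hz k).2.2.1).le hrT.le
        (fun s hs => core_mono (le_max_right i j) ((hz k).2.2.2 s ⟨hs.1, hs.2.trans hk.le⟩))
        (fun s hs => core_mono (le_max_left i j) (hi s hs))
    refine hcl.mem_of_tendsto hlim ?_
    filter_upwards [hw1.eventually_const_lt hrt] with k hk using (hz k).2.2.2 r ⟨hr0, hk.le⟩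
  have hclosed : ∀ r, 0 ≤ r → r ≤ w.1 → r ≤ τ w.2 → Γ w.2 r ∈ P.core S j := by
    intro r hr0 hrt hrT
    rcases hr0.eq_or_lt with rfl | hpos
    · rwa [hTw.start]
    · refine hcl.mem_of_tendsto (hTw.tendsto_left hpos hrT) ?_
      filter_upwards [Ico_mem_nhdsLT hpos] with s hs
      exact hinner s hs.1 (hs.2.trans_le hrt) (hs.2.trans_le hrT)
  -- Otherwise the trajectory would still be in the core at its arrival. No continuity of `τ` is
  -- used.
  have hlt : w.1 < τ w.2 := by
    by_contra! hle
    exact core_subset_compl j (hclosed _ hTw.time_nonneg hle le_rfl) hTw.arrival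
  exact ⟨hwS, hw0, hlt, fun s hs => hclosed s hs.1 hs.2 (hs.2.trans hlt.le)⟩

/-- Two trajectories are compared at the earlier of the two times, where both are still in the core;
bounded speed covers the remaining time. -/
theorem continuousOn_staySet (j : ℕ) :
    ContinuousOn (fun z : ℝ × Euc n => Γ z.2 z.1) (P.staySet S τ Γ j) := by
  have hF := hA.continuousOn_closedLoop
  obtain ⟨M, hM⟩ := hA.bounded
  obtain ⟨K, hK⟩ := hA.exists_lipschitzOnWith_core hS j
  intro w hw
  rw [ContinuousWithinAt, tendsto_iff_dist_tendsto_zero]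
  have hb : Tendsto (fun z : ℝ × Euc n => 2 * (|M| * |z.1 - w.1|) +
      dist z.2 w.2 * Real.exp (K * w.1)) (𝓝[P.staySet S τ Γ j] w) (𝓝 0) := by
    have : Continuous fun z : ℝ × Euc n => 2 * (|M| * |z.1 - w.1|) +
      dist z.2 w.2 * Real.exp (K * w.1) := by fun_prop
    simpa using (this.tendsto w).mono_left nhdsWithin_le_nhds
  refine squeeze_zero' (Eventually.of_forall fun _ => dist_nonneg) ?_ hb
  filter_upwards [self_mem_nhdsWithin] with z hz
  have hr0 : 0 ≤ min z.1 w.1 := le_min hz.2.1 hw.2.1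
  have htime : ∀ y ∈ P.staySet S τ Γ j, min z.1 w.1 ≤ y.1 → y.1 - min z.1 w.1 ≤ |z.1 - w.1| →
      dist (Γ y.2 y.1) (Γ y.2 (min z.1 w.1)) ≤ |M| * |z.1 - w.1| := fun y hy h1 h2 => by
    refine ((hΓ _ hy.1).dist_le_mul_abs_sub hc hF hM hr0 h1 hy.2.2.1.le).trans ?_
    exact mul_le_mul (le_abs_self M) h2 (sub_nonneg.2 h1) (abs_nonneg M)
  have habs : z.1 - min z.1 w.1 ≤ |z.1 - w.1| ∧ w.1 - min z.1 w.1 ≤ |z.1 - w.1| := by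
    rcases le_total z.1 w.1 with h | h
    · rw [min_eq_left h, abs_sub_comm]
      exact ⟨by simp, le_abs_self _⟩
    · rw [min_eq_right h]
      exact ⟨le_abs_self _, by simp⟩
  have e1 := htime z hz (min_le_left _ _) habs.1
  have e2 := htime w hw (min_le_right _ _) habs.2
  have e3 := (hΓ _ hz.1).dist_le_forward (hΓ _ hw.1) hc hF hK hr0
    ((min_le_left _ _).trans hz.2.2.1.le) ((min_le_right _ _).trans hw.2.2.1.le)
    (fun s hs => hz.2.2.2 s ⟨hs.1, hs.2.trans (min_le_left _ _)⟩)
    (fun s hs => hw.2.2.2 s ⟨hs.1, hs.2.trans (min_le_right _ _)⟩)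
  have e4 : dist z.2 w.2 * Real.exp (K * min z.1 w.1) ≤ dist z.2 w.2 * Real.exp (K * w.1) := by
    gcongr
    exact min_le_right _ _
  rw [dist_comm] at e2
  have e5 := dist_triangle4 (Γ z.2 z.1) (Γ z.2 (min z.1 w.1)) (Γ w.2 (min z.1 w.1)) (Γ w.2 w.1)
  linarith

theorem measurableSet_activeSet : MeasurableSet (activeSet S τ) := by
  rw [← iUnion_staySet hΓ hc]
  exact MeasurableSet.iUnion fun j => (isClosed_staySet hΓ hA hc hS j).measurableSet

/-- Neither `τ` nor `Γ` is assumed measurable: the active set is a countable increasing union of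
closed sets on each of which the flow is continuous. -/
theorem measurable_indicator_activeSet :
    Measurable ((activeSet S τ).indicator fun z : ℝ × Euc n => Γ z.2 z.1) := by
  classical
  have hmono : Monotone (P.staySet S τ Γ) := fun i j hij z hz =>
    ⟨hz.1, hz.2.1, hz.2.2.1, fun s hs => core_mono hij (hz.2.2.2 s hs)⟩
  refine measurable_of_tendsto_metrizable
    (f := fun j => (P.staySet S τ Γ j).indicator fun z : ℝ × Euc n => Γ z.2 z.1) (fun j => ?_) ?_
  · rw [← piecewise_eq_indicator]
    exact (continuousOn_staySet hΓ hA hc hS j).measurable_piecewise continuousOn_const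
      (isClosed_staySet hΓ hA hc hS j).measurableSet
  · rw [tendsto_pi_nhds]
    intro z
    rw [← iUnion_staySet hΓ hc]
    exact (hmono.tendsto_indicator _ _ z).trans (pure_le_nhds _)

/-- The states that are carried into a null set at a given time form a null set. -/
theorem volume_preimage_eq_zero {A : Set (Euc n)} (h0 : volume A = 0) (t : ℝ) :
    volume {x | (t, x) ∈ activeSet S τ ∧ Γ x t ∈ A} = 0 := by
  have hsub : {x | (t, x) ∈ activeSet S τ ∧ Γ x t ∈ A} ⊆
      ⋃ j, {x | (t, x) ∈ P.staySet S τ Γ j ∧ Γ x t ∈ A} := fun x hx => by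
    have := hx.1
    rw [← iUnion_staySet hΓ hc] at this
    obtain ⟨j, hj⟩ := mem_iUnion.1 this
    exact mem_iUnion.2 ⟨j, hj, hx.2⟩
  refine measure_mono_null hsub (measure_iUnion_null fun j => ?_)
  obtain ⟨K, hK⟩ := hA.exists_lipschitzOnWith_core hS j
  refine volume_eq_zero_of_dist_le_mul (h := fun x => Γ x t) (K := Real.exp (K * t))
    (Real.exp_pos _).le (fun x hx y hy => ?_) (fun x hx => hx.2) h0
  rw [mul_comm]
  exact (hΓ _ hx.1.1).dist_le_backward (hΓ _ hy.1.1) hK hx.1.2.1 hx.1.2.2.1 hy.1.2.2.1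
    hx.1.2.2.2 hy.1.2.2.2

end IsFlow

end ControlProblem

/-! ### The occupation measure as a stationary decision that attains the dual value. -/

namespace ControlProblem

variable {n m : ℕ} {P : ControlProblem n m} {S : Set (Euc n)} {u : Euc n → Euc m}
  {τ : Euc n → ℝ} {Γ : Euc n → ℝ → Euc n}

/-- The measure `φ₊ dx`. -/
def supplyMeasure (P : ControlProblem n m) : Measure (Euc n) :=
  volume.withDensity fun x => ENNReal.ofReal (P.supply x)

/-- The state at a given time, as a function of time and initial state; zero after arrival. -/
def flowMap (S : Set (Euc n)) (τ : Euc n → ℝ) (Γ : Euc n → ℝ → Euc n) : ℝ × Euc n → Euc n :=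
  (activeSet S τ).indicator fun z => Γ z.2 z.1

/-- The expected time that the supplied states spend in a set before they reach the target. -/
def occupation (P : ControlProblem n m) (S : Set (Euc n)) (τ : Euc n → ℝ)
    (Γ : Euc n → ℝ → Euc n) : Measure (Euc n) :=
  ((volume.prod P.supplyMeasure).restrict (activeSet S τ)).map (flowMap S τ Γ)

/-- The decision that follows the strategy `u` from the supply until the arrival at the target. -/
def occupationDecision (P : ControlProblem n m) (u : Euc n → Euc m) (S : Set (Euc n))
    (τ : Euc n → ℝ) (Γ : Euc n → ℝ → Euc n) : DensityDecision n m where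
  -- The Radon–Nikodym derivative is fixed only almost everywhere; the indicator makes it vanish at
  -- every point of the target and outside S.
  rho := (S \ P.target).indicator fun x => ((P.occupation S τ Γ).rnDeriv volume x).toReal
  u := u
  -- This pushforward would be zero by default without the almost-everywhere measurability given by
  -- `aemeasurable_arrival`.
  sink := P.supplyMeasure.map fun x => Γ x (τ x)

theorem preimage_activeSet_of_mem {x : Euc n} (hx : x ∈ S) :
    (fun t => (t, x)) ⁻¹' activeSet S τ = Ico 0 (τ x) := by
  ext t; simp [activeSet, hx]

theorem supplyMeasure_absolutelyContinuous : P.supplyMeasure ≪ volume :=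
  withDensity_absolutelyContinuous _ _

namespace IsRegular

variable (hP : P.IsRegular S)
include hP

theorem isFiniteMeasure_supplyMeasure : IsFiniteMeasure P.supplyMeasure :=
  isFiniteMeasure_withDensity_ofReal hP.integrable_supply.2

theorem ae_supplyMeasure_mem : ∀ᵐ x ∂P.supplyMeasure, x ∈ S := by
  have hm := hP.isCompact_S.isClosed.measurableSet.compl
  change P.supplyMeasure Sᶜ = 0
  rw [supplyMeasure, withDensity_apply _ hm]
  refine (setLIntegral_congr_fun hm fun x hx => ?_).trans lintegral_zero
  simp [hP.supply_eq_zero x hx]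

theorem integral_supplyMeasure (f : Euc n → ℝ) :
    ∫ x, f x ∂P.supplyMeasure = ∫ x, f x * P.supply x := by
  rw [supplyMeasure, integral_withDensity_eq_integral_toReal_smul₀
    hP.integrable_supply.1.aemeasurable.ennreal_ofReal (ae_of_all _ fun _ => ENNReal.ofReal_lt_top)]
  refine integral_congr_ae (ae_of_all _ fun x => ?_)
  simp [ENNReal.toReal_ofReal (hP.supply_nonneg x), mul_comm]

end IsRegular

namespace IsFlow

variable (hΓ : P.IsFlow u S τ Γ) (hA : P.IsAbsorbing u S τ) (hP : P.IsRegular S)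
include hΓ hA hP

theorem measurableSet_active : MeasurableSet (activeSet S τ) :=
  measurableSet_activeSet hΓ hA hP.isClosed_target hP.isCompact_S

theorem measurable_flowMap : Measurable (flowMap S τ Γ) :=
  measurable_indicator_activeSet hΓ hA hP.isClosed_target hP.isCompact_S

/-- By Tonelli, this mass is the integral of φ₊τ. -/
theorem prod_activeSet_lt_top : (volume.prod P.supplyMeasure) (activeSet S τ) < ⊤ := by
  have := hP.isFiniteMeasure_supplyMeasure
  have hm := measurableSet_active hΓ hA hP
  rw [Measure.prod_apply_symm hm, supplyMeasure, lintegral_withDensity_eq_lintegral_mul₀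
    hP.integrable_supply.1.aemeasurable.ennreal_ofReal
    (measurable_measure_prodMk_right hm).aemeasurable]
  refine lt_of_le_of_lt (lintegral_mono fun x => ?_) hA.finite_mass.lintegral_lt_top
  by_cases hx : x ∈ S
  · simp only [Pi.mul_apply, preimage_activeSet_of_mem hx, Real.volume_Ico, sub_zero]
    rw [ENNReal.ofReal_mul (hP.supply_nonneg x)]
  · simp [hP.supply_eq_zero x hx]

theorem isFiniteMeasure_occupation : IsFiniteMeasure (P.occupation S τ Γ) := by
  have : IsFiniteMeasure ((volume.prod P.supplyMeasure).restrict (activeSet S τ)) :=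
    ⟨by rw [Measure.restrict_apply_univ]; exact prod_activeSet_lt_top hΓ hA hP⟩
  exact Measure.isFiniteMeasure_map _ _

theorem ae_occupation_mem : ∀ᵐ x ∂P.occupation S τ Γ, x ∈ S \ P.target := by
  have hm : MeasurableSet (S \ P.target) :=
    hP.isCompact_S.isClosed.measurableSet.diff hP.isClosed_target.measurableSet
  refine (ae_map_iff (p := (· ∈ S \ P.target)) (measurable_flowMap hΓ hA hP).aemeasurable hm).2 ?_
  rw [ae_restrict_iff' (measurableSet_active hΓ hA hP)]
  refine ae_of_all _ fun z hz => ?_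
  rw [flowMap, indicator_of_mem hz]
  exact ⟨(hΓ _ hz.1).invariant _ ⟨hz.2.1, hz.2.2.le⟩, (hΓ _ hz.1).before _ hz.2⟩

/-- By Fubini it suffices to look at one time at a time, where backward Gronwall makes the preimage
of a null set null. -/
theorem occupation_absolutelyContinuous : P.occupation S τ Γ ≪ volume := by
  have := hP.isFiniteMeasure_supplyMeasure
  refine Measure.AbsolutelyContinuous.mk fun A hA' h0 => ?_
  have hf := measurable_flowMap hΓ hA hP
  have hact := measurableSet_active hΓ hA hP
  rw [occupation, Measure.map_apply hf hA', Measure.restrict_apply (hf hA'),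
    Measure.measure_prod_null ((hf hA').inter hact)]
  refine ae_of_all _ fun t => supplyMeasure_absolutelyContinuous ?_
  refine measure_mono_null (fun x hx => ?_)
    (volume_preimage_eq_zero hΓ hA hP.isClosed_target hP.isCompact_S h0 t)
  refine ⟨hx.2, ?_⟩
  have h1 : flowMap S τ Γ (t, x) ∈ A := hx.1
  rwa [flowMap, indicator_of_mem hx.2] at h1

omit hΓ hA hP in
theorem rho_smul_eq {E : Type*} [NormedAddCommGroup E] [NormedSpace ℝ E] (f : Euc n → E) :
    (fun x => (P.occupationDecision u S τ Γ).rho x • f x) = fun x =>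
      ((P.occupation S τ Γ).rnDeriv volume x).toReal • (S \ P.target).indicator f x := by
  ext x
  by_cases hx : x ∈ S \ P.target
  · simp only [occupationDecision, indicator_of_mem hx]
  · simp only [occupationDecision, indicator_of_notMem hx, zero_smul, smul_zero]

theorem ae_indicator_eq {E : Type*} [NormedAddCommGroup E] (f : Euc n → E) :
    (S \ P.target).indicator f =ᵐ[P.occupation S τ Γ] f := by
  filter_upwards [ae_occupation_mem hΓ hA hP] with x hx using indicator_of_mem hx f

theorem integrable_rho_smul {E : Type*} [NormedAddCommGroup E] [NormedSpace ℝ E] {f : Euc n → E}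
    (hf : Integrable f (P.occupation S τ Γ)) :
    Integrable fun x => (P.occupationDecision u S τ Γ).rho x • f x := by
  have := isFiniteMeasure_occupation hΓ hA hP
  rw [rho_smul_eq, integrable_rnDeriv_smul_iff (occupation_absolutelyContinuous hΓ hA hP)]
  exact hf.congr (ae_indicator_eq hΓ hA hP f).symm

theorem integral_rho_mul (f : Euc n → ℝ) :
    ∫ x, (P.occupationDecision u S τ Γ).rho x * f x = ∫ x, f x ∂P.occupation S τ Γ := by
  have := isFiniteMeasure_occupation hΓ hA hP
  have h := rho_smul_eq (P := P) (u := u) (S := S) (τ := τ) (Γ := Γ) f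
  simp only [smul_eq_mul] at h
  rw [h, ← integral_congr_ae (ae_indicator_eq hΓ hA hP f)]
  exact integral_rnDeriv_smul (occupation_absolutelyContinuous hΓ hA hP)

theorem aestronglyMeasurable_closedLoop :
    AEStronglyMeasurable (P.closedLoop u) (P.occupation S τ Γ) := by
  have h1 : (P.occupation S τ Γ).restrict P.targetᶜ = P.occupation S τ Γ :=
    Measure.restrict_eq_self_of_ae_mem ((ae_occupation_mem hΓ hA hP).mono fun x hx => hx.2)
  rw [← h1]
  exact hA.continuousOn_closedLoop.aestronglyMeasurable
    hP.isClosed_target.isOpen_compl.measurableSet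

theorem integrable_closedLoop : Integrable (P.closedLoop u) (P.occupation S τ Γ) := by
  have := isFiniteMeasure_occupation hΓ hA hP
  obtain ⟨M, hM⟩ := hA.bounded
  refine (integrable_const M).mono' (aestronglyMeasurable_closedLoop hΓ hA hP) ?_
  filter_upwards [ae_occupation_mem hΓ hA hP] with x hx using hM x hx

omit hΓ in
theorem exists_norm_fderiv_closedLoop_le {μ : Euc n → ℝ} (hμ : LocallyLipschitz μ) :
    ∃ C : ℝ, ∀ x ∈ S \ P.target, ‖fderiv ℝ μ x (P.closedLoop u x)‖ ≤ C := by
  obtain ⟨M, hM⟩ := hA.bounded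
  obtain ⟨K, hK⟩ := exists_norm_fderiv_le hμ hP.isCompact_S.isBounded
  refine ⟨K * M, fun x hx => ?_⟩
  have hK0 : 0 ≤ K := (norm_nonneg _).trans (hK x hx.1)
  exact ((fderiv ℝ μ x).le_of_opNorm_le (hK x hx.1) _).trans
    (mul_le_mul_of_nonneg_left (hM x hx) hK0)

theorem integrable_fderiv_closedLoop {μ : Euc n → ℝ} (hμ : LocallyLipschitz μ) :
    Integrable (fun x => fderiv ℝ μ x (P.closedLoop u x)) (P.occupation S τ Γ) := by
  have := isFiniteMeasure_occupation hΓ hA hP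
  obtain ⟨C, hC⟩ := exists_norm_fderiv_closedLoop_le hA hP hμ
  refine (integrable_const C).mono' ?_ ?_
  · exact (isBoundedBilinearMap_apply (𝕜 := ℝ) (E := Euc n)
      (F := ℝ)).continuous.comp_aestronglyMeasurable
      ((measurable_fderiv ℝ μ).aestronglyMeasurable.prodMk
        (aestronglyMeasurable_closedLoop hΓ hA hP))
  · filter_upwards [ae_occupation_mem hΓ hA hP] with x hx using hC x hx

/-- The fundamental theorem of calculus along a trajectory. -/
theorem integral_fderiv_closedLoop {μ : Euc n → ℝ} (hμ : μ ∈ P.multipliers) {x : Euc n}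
    (hx : x ∈ S) :
    ∫ t in Ico 0 (τ x), fderiv ℝ μ (Γ x t) (P.closedLoop u (Γ x t)) = μ (Γ x (τ x)) - μ x := by
  have h := hΓ x hx
  obtain ⟨C, hC⟩ := exists_norm_fderiv_closedLoop_le hA hP hμ.1
  have hint : IntegrableOn (fun t => fderiv ℝ μ (Γ x t) (P.closedLoop u (Γ x t)))
      (Ioo 0 (τ x)) := by
    refine Integrable.of_bound ?_ C ?_
    -- Measurability in time comes for free, since the integrand is a derivative.
    · refine (measurable_deriv fun s => μ (Γ x s)).aestronglyMeasurable.congr ?_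
      filter_upwards [ae_restrict_mem measurableSet_Ioo] with t ht
      exact (h.hasDerivAt_comp hμ ht).deriv
    · filter_upwards [ae_restrict_mem measurableSet_Ioo] with t ht
      exact hC _ ⟨h.invariant t ⟨ht.1.le, ht.2.le⟩, h.before t ⟨ht.1.le, ht.2⟩⟩
  have hFTC := intervalIntegral.integral_eq_sub_of_hasDerivAt_of_le h.time_nonneg
    (h.continuousOn_comp hμ) (fun t ht => h.hasDerivAt_comp hμ ht)
    ((intervalIntegrable_iff_integrableOn_Ioo_of_le h.time_nonneg).2 hint)
  rw [intervalIntegral.integral_of_le h.time_nonneg, h.start] at hFTC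
  rw [integral_Ico_eq_integral_Ioo, ← integral_Ioc_eq_integral_Ioo, hFTC]

/-- Fubini reduces the integral to single trajectories, where it telescopes to the difference
between arrival and start. -/
theorem integral_occupation {μ : Euc n → ℝ} (hμ : μ ∈ P.multipliers) :
    ∫ x, fderiv ℝ μ x (P.closedLoop u x) ∂P.occupation S τ Γ =
      ∫ x, (μ (Γ x (τ x)) - μ x) ∂P.supplyMeasure := by
  have := hP.isFiniteMeasure_supplyMeasure
  have hi := integrable_fderiv_closedLoop hΓ hA hP hμ.1
  have hf := (measurable_flowMap hΓ hA hP).aemeasurable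
    (μ := (volume.prod P.supplyMeasure).restrict (activeSet S τ))
  have hact := measurableSet_active hΓ hA hP
  have hi2 := (integrable_indicator_iff hact).2
    ((integrable_map_measure hi.1 hf).1 hi)
  rw [occupation, integral_map hf hi.1, ← integral_indicator hact]
  refine (integral_prod_symm _ hi2).trans (integral_congr_ae ?_)
  filter_upwards [hP.ae_supplyMeasure_mem] with x hx
  rw [← integral_fderiv_closedLoop hΓ hA hP hμ hx, ← integral_indicator measurableSet_Ico]
  refine integral_congr_ae (ae_of_all _ fun t => ?_)
  have hiff : (t, x) ∈ activeSet S τ ↔ t ∈ Ico 0 (τ x) := by simp [activeSet, hx]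
  by_cases ht : t ∈ Ico 0 (τ x)
  · have ht' := hiff.2 ht
    simp only [indicator_of_mem ht, indicator_of_mem ht', Function.comp, flowMap]
  · have ht' := fun h => ht (hiff.1 h)
    simp only [indicator_of_notMem ht, indicator_of_notMem ht']

/-- The arrival point is a limit of states at times strictly before arrival, because `flowMap` is
zero from the arrival on. States that start in the target arrive at time 0 and are treated
separately. -/
theorem aemeasurable_arrival : AEMeasurable (fun x => Γ x (τ x)) P.supplyMeasure := by
  classical
  have hact := measurableSet_active hΓ hA hP
  -- The length of the active time section is a measurable function that agrees with `τ` on S.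
  set θ : Euc n → ℝ := fun x => (volume ((fun t => (t, x)) ⁻¹' activeSet S τ)).toReal
  have hθ : Measurable θ := (measurable_measure_prodMk_right hact).ennreal_toReal
  have hθS : ∀ x ∈ S, θ x = τ x := fun x hx => by
    simp only [θ, preimage_activeSet_of_mem hx, Real.volume_Ico, sub_zero,
      ENNReal.toReal_ofReal (hΓ x hx).time_nonneg]
  refine aemeasurable_of_tendsto_metrizable_ae atTop
    (f := fun (k : ℕ) => P.target.piecewise id
      fun x => flowMap S τ Γ ((1 - 1 / ((k : ℝ) + 1)) * θ x, x)) (fun k => ?_) ?_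
  · refine (Measurable.piecewise hP.isClosed_target.measurableSet measurable_id ?_).aemeasurable
    exact (measurable_flowMap hΓ hA hP).comp ((measurable_const.mul hθ).prodMk measurable_id)
  · filter_upwards [hP.ae_supplyMeasure_mem] with x hx
    have h := hΓ x hx
    by_cases hxt : x ∈ P.target
    · simp [hxt, h.time_eq_zero hxt, h.start]
    · have hpos := h.time_pos hxt
      have hmem : ∀ k : ℕ, (1 - 1 / ((k : ℝ) + 1)) * τ x ∈ Ico 0 (τ x) := fun k => by
        have h1 : (0 : ℝ) < 1 / ((k : ℝ) + 1) := by positivity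
        have h2 : 1 / ((k : ℝ) + 1) ≤ 1 := by
          rw [div_le_one (by positivity)]
          have : (0 : ℝ) ≤ k := k.cast_nonneg
          linarith
        exact ⟨mul_nonneg (by linarith) hpos.le, by nlinarith⟩
      have hlim : Tendsto (fun k : ℕ => (1 - 1 / ((k : ℝ) + 1)) * τ x) atTop (𝓝[<] τ x) := by
        refine tendsto_nhdsWithin_iff.2 ⟨?_, Eventually.of_forall fun k => (hmem k).2⟩
        have := ((tendsto_one_div_add_atTop_nhds_zero_nat (𝕜 := ℝ)).const_sub 1).mul_const (τ x)
        simpa using this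
      refine ((h.tendsto_left hpos le_rfl).comp hlim).congr fun k => ?_
      have hk : ((1 - 1 / ((k : ℝ) + 1)) * τ x, x) ∈ activeSet S τ := ⟨hx, hmem k⟩
      rw [piecewise_eq_of_notMem _ _ _ hxt, hθS x hx, flowMap, indicator_of_mem hk]
      rfl

omit hA hP in
theorem arrival_mem_interior_iff {x : Euc n} (hx : x ∈ S) :
    Γ x (τ x) ∈ interior P.target ↔ x ∈ interior P.target := by
  have h := hΓ x hx
  by_cases hxt : x ∈ P.target
  · rw [h.time_eq_zero hxt, h.start]
  · refine iff_of_false (fun hi => ?_) fun hi => hxt (interior_subset hi)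
    exact disjoint_left.1 disjoint_interior_frontier hi (h.arrival_mem_frontier hxt)

/-- Trajectories from outside arrive on the frontier, so whatever lies in the interior of the target
started there and never moved. -/
theorem sink_restrict_interior :
    (P.occupationDecision u S τ Γ).sink.restrict (interior P.target) =
      (volume.restrict (interior P.target)).withDensity fun x => ENNReal.ofReal (P.supply x) := by
  have hi : MeasurableSet (interior P.target) := isOpen_interior.measurableSet
  have har := aemeasurable_arrival hΓ hA hP
  rw [← restrict_withDensity hi]
  ext A hAm
  rw [Measure.restrict_apply hAm, Measure.restrict_apply hAm, occupationDecision,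
    Measure.map_apply_of_aemeasurable har (hAm.inter hi)]
  refine measure_congr ?_
  filter_upwards [hP.ae_supplyMeasure_mem] with x hx
  refine propext ?_
  change (Γ x (τ x) ∈ A ∧ Γ x (τ x) ∈ interior P.target) ↔ (x ∈ A ∧ x ∈ interior P.target)
  rw [arrival_mem_interior_iff hΓ hx]
  refine and_congr_left fun hxi => ?_
  rw [(hΓ x hx).time_eq_zero (interior_subset hxi), (hΓ x hx).start]

theorem isDensityDecision (hu : Measurable u) (hU : ∀ x, u x ∈ P.controlSet)
    {V : Euc n → ℝ} (hV : LocallyLipschitz V)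
    (hC : ∀ x ∉ P.target, P.closedLoopCost u x + fderiv ℝ V x (P.closedLoop u x) = 0) :
    P.IsDensityDecision (P.occupationDecision u S τ Γ) where
  measurable_u := hu
  u_mem := hU
  rho_nonneg x := indicator_nonneg (fun _ _ => ENNReal.toReal_nonneg) x
  rho_integrable := by
    have := isFiniteMeasure_occupation hΓ hA hP
    simpa using integrable_rho_smul hΓ hA hP (integrable_const (1 : ℝ))
  rho_compact := HasCompactSupport.of_support_subset_isCompact hP.isCompact_S
    fun x hx => (support_indicator_subset hx).1
  rho_target x hx := by
    simp [occupationDecision, hx]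
  flux_integrable := integrable_rho_smul hΓ hA hP (integrable_closedLoop hΓ hA hP)
  cost_integrable := by
    -- The HJB equation replaces the cost by -∇V·F_u, which is bounded on S off the target.
    refine integrable_rho_smul hΓ hA hP ((integrable_fderiv_closedLoop hΓ hA hP hV).neg.congr ?_)
    filter_upwards [ae_occupation_mem hΓ hA hP] with x hx
    have := hC x hx.2
    simp only [Pi.neg_apply]
    change _ = P.closedLoopCost u x
    linarith
  sink_finite := by
    have := hP.isFiniteMeasure_supplyMeasure
    exact Measure.isFiniteMeasure_map _ _
  sink_compl := by
    rw [occupationDecision, Measure.map_apply_of_aemeasurable (aemeasurable_arrival hΓ hA hP)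
      hP.isClosed_target.measurableSet.compl]
    exact hP.ae_supplyMeasure_mem.mono fun x hx => (hΓ x hx).arrival
  sink_interior := sink_restrict_interior hΓ hA hP

/-- The telescoped flux term is arrival minus start, which cancels the sink and supply terms. -/
theorem liouvillePairing_occupationDecision {μ : Euc n → ℝ} (hμ : μ ∈ P.multipliers)
    (hp : P.IsDensityDecision (P.occupationDecision u S τ Γ)) :
    P.liouvillePairing (P.occupationDecision u S τ Γ) μ = 0 := by
  have hc := hμ.1.continuous
  have har := aemeasurable_arrival hΓ hA hP
  have h1 : Integrable (fun x => μ (Γ x (τ x))) P.supplyMeasure :=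
    (hP.integrable_sink hp hc.continuousOn).comp_aemeasurable har
  have h2 : Integrable μ P.supplyMeasure := by
    have := hP.isFiniteMeasure_supplyMeasure
    have h3 : P.supplyMeasure.restrict S = P.supplyMeasure :=
      Measure.restrict_eq_self_of_ae_mem hP.ae_supplyMeasure_mem
    rw [← h3]
    exact hc.continuousOn.integrableOn_compact hP.isCompact_S
  have h3 : ∫ x, μ x ∂(P.occupationDecision u S τ Γ).sink =
      ∫ x, μ (Γ x (τ x)) ∂P.supplyMeasure :=
    integral_map har hc.aestronglyMeasurable
  have h4 := integral_rho_mul hΓ hA hP fun x => fderiv ℝ μ x (P.closedLoop u x)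
  rw [integral_occupation hΓ hA hP hμ, integral_sub h1 h2] at h4
  rw [liouvillePairing, h3, ← hP.integral_supplyMeasure μ]
  change _ + ∫ x, (P.occupationDecision u S τ Γ).rho x * fderiv ℝ μ x (P.closedLoop u x) = 0
  rw [h4]
  ring

end IsFlow

/-- The value of an HJB solution with an absorbing closed loop is attained by a stationary
decision. -/
theorem IsRegular.exists_stationary_decision (hP : P.IsRegular S) {V : Euc n → ℝ}
    (h : P.IsHJBSolution V u) (hA : P.IsAbsorbing u S τ) :
    ∃ p, P.IsDensityDecision p ∧ P.IsStationary p ∧ P.densityCost p = P.valueObjective V := by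
  obtain ⟨Γ, hΓ⟩ : ∃ Γ, P.IsFlow u S τ Γ := by
    choose! Γ hΓ using hA.trajectory
    exact ⟨Γ, hΓ⟩
  have hp := hΓ.isDensityDecision hA hP h.measurable_u h.u_mem h.regular.1 h.hjb
  have h0 : ∀ μ ∈ P.multipliers, P.liouvillePairing (P.occupationDecision u S τ Γ) μ = 0 :=
    fun μ hμ => hΓ.liouvillePairing_occupationDecision hA hP hμ hp
  refine ⟨_, hp, fun ψ hψ _ => h0 ψ ⟨(hψ.of_le (by exact_mod_cast le_top) :
    ContDiff ℝ 1 ψ).locallyLipschitz, fun x _ => hψ.differentiable (by simp) x⟩, ?_⟩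
  -- In the splitting with multiplier V the running term vanishes by the HJB equation and the
  -- boundary term by V = D, leaving ⟨φ₊, V⟩.
  have h1 := hP.lagrangian_eq hp h.regular.1
  rw [lagrangian, h0 V h.regular, h.valueExtension_eq, add_zero] at h1
  have h2 : ∫ x, (P.occupationDecision u S τ Γ).rho x *
      P.hamiltonian V x ((P.occupationDecision u S τ Γ).u x) = 0 := by
    refine integral_eq_zero_of_ae (ae_of_all _ fun x => ?_)
    by_cases hx : x ∈ P.target
    · simp [hp.rho_target x hx]
    · have : P.hamiltonian V x (u x) = 0 := by rw [← h.hjb x hx]; exact add_comm _ _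
      change _ * P.hamiltonian V x (u x) = 0
      rw [this, mul_zero]
  have h3 : P.boundaryCost (P.occupationDecision u S τ Γ) V = 0 :=
    setIntegral_eq_zero_of_forall_eq_zero fun x hx => by
      rw [h.terminal x (hP.isClosed_target.frontier_subset hx), sub_self]
  rw [h1, h2, h3, add_zero, zero_add]

end ControlProblem

end

/-! ### Assembly of both parts of the theorem. -/

theorem mainTheorem1 {n m : ℕ} (P : ControlProblem n m) (S : Set (Euc n))
    (hF : ContinuousOn (Function.uncurry P.F) (Set.univ ×ˢ P.controlSet))
    (hC : ContinuousOn (Function.uncurry P.C) (Set.univ ×ˢ P.controlSet))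
    (hU : P.controlSet.Nonempty)
    (hXg : IsCompact P.target)
    (hD : ContinuousOn P.D P.target)
    (hS : IsCompact S)
    (hsupply_nonneg : ∀ x, 0 ≤ P.supply x)
    (hsupply_int : MeasureTheory.Integrable P.supply)
    (hsupply_S : ∀ x ∉ S, P.supply x = 0) :
    -- the Lagrange dual function: the multiplier must satisfy the HJB inequality,
    -- and the resulting dual objective is `⟨φ₊, V⟩`
    (∀ μ ∈ P.multipliers,
      (P.IsSubsolution μ →
        P.dualFunction μ = ((P.valueObjective (P.valueExtension μ) : ℝ) : EReal)) ∧
      (¬ P.IsSubsolution μ → P.dualFunction μ = ⊥)) ∧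
    -- conversely, maximizing the same Lagrangian over the multipliers gives the density problem
    (∀ p ∈ P.decisions,
      (P.IsStationary p →
        (⨆ μ ∈ P.multipliers, ((P.lagrangian p μ : ℝ) : EReal)) =
          ((P.densityCost p : ℝ) : EReal)) ∧
      (¬ P.IsStationary p →
        (⨆ μ ∈ P.multipliers, ((P.lagrangian p μ : ℝ) : EReal)) = ⊤)) ∧
    -- a solution of the HJB problem
    (∀ (V : Euc n → ℝ) (u : Euc n → Euc m) (τ : Euc n → ℝ),
      P.IsHJBSolution V u → P.IsAbsorbing u S τ →
      -- is an optimal solution of the Lagrange dual, with value `⟨φ₊, V⟩`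
      P.IsSubsolution V ∧
      P.dualFunction V = ((P.valueObjective V : ℝ) : EReal) ∧
      (∀ μ ∈ P.multipliers, P.dualFunction μ ≤ P.dualFunction V) ∧
      -- and for every optimal solution of the density problem
      (∀ p : DensityDecision n m, P.IsOptimalDensity p →
        -- there is no duality gap
        P.valueObjective V = P.densityCost p ∧
        -- and every optimal multiplier solves the HJB problem wherever there are states
        (∀ μ ∈ P.multipliers, P.dualFunction μ = P.dualFunction V →
          (∀ᵐ x, 0 < p.rho x →
            IsMinOn (P.hamiltonian μ x) P.controlSet (p.u x) ∧
            P.closedLoopCost p.u x + fderiv ℝ μ x (P.closedLoop p.u x) = 0) ∧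
          (∀ᵐ x ∂p.sink, x ∈ frontier P.target → μ x = P.D x)))) := by
  have hP : P.IsRegular S := ⟨hF, hC, hU, hXg, hD, hS, hsupply_nonneg, hsupply_int, hsupply_S⟩
  refine ⟨fun μ hμ => ⟨hP.dualFunction_of_isSubsolution hμ,
    hP.dualFunction_of_not_isSubsolution hμ⟩, fun p hp =>
      ⟨hP.iSup_lagrangian_of_isStationary hp,
        ControlProblem.IsRegular.iSup_lagrangian_of_not_isStationary⟩,
    fun V u τ hV hA => ⟨hV.isSubsolution hP.isClosed_target, hP.dualFunction_of_isHJBSolution hV,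
      fun μ hμ => hP.dualFunction_le hV hA hμ, ?_⟩⟩
  rintro p ⟨hp, hst, hopt⟩
  -- One inequality is weak duality with multiplier V; the other compares the optimal `p` with the
  -- occupation decision.
  have hval : P.valueObjective V = P.densityCost p := by
    refine le_antisymm ?_ ?_
    · have h1 := hP.lagrangian_ge hp hV.regular (hV.isSubsolution hP.isClosed_target)
      rwa [hV.valueExtension_eq, ControlProblem.lagrangian,
        hP.liouvillePairing_eq_zero hp hst hV.regular.1, add_zero] at h1
    · obtain ⟨q, hq, hqs, hqv⟩ := hP.exists_stationary_decision hV hA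
      exact (hopt q hq hqs).trans hqv.le
  refine ⟨hval, fun μ hμ heq => ?_⟩
  rw [hP.dualFunction_of_isHJBSolution hV] at heq
  have hs : P.IsSubsolution μ := by
    by_contra hn
    rw [hP.dualFunction_of_not_isSubsolution hμ hn] at heq
    exact EReal.bot_ne_coe _ heq
  rw [hP.dualFunction_of_isSubsolution hμ hs, EReal.coe_eq_coe_iff] at heq
  exact hP.complementary_slackness hp hst hμ hs (hval.symm.trans heq.symm)
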